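/- **Model.** Terminals $A$ and $B$ hold independent, uniformly distributed messages $u_A,u_B\in\{0,1\}^k$ and exchange them through a relay. In the multiple access phase ($n$ channel uses) they send $x_1,x_2\in\mathbb R^n$ and the relay receives $y_R=x_1+x_2+z_R$. In the broadcast phase ($n$ further uses) the relay sends $x_R\in\mathbb R^n$, a function of $y_R$, and the terminals receive $y_A=x_R+z_A$ and $y_B=x_R+z_B$. The noises $z_R,z_A,z_B$ are independent, with i.i.d. $\mathcal N(0,\sigma^2)$ entries. Terminal $A$ estimates $u_B$ from $(u_A,y_A)$ and $B$ estimates $u_A$ from $(u_B,y_B)$; all maps are measurable and may depend on a common random seed that is independent of messages and noises. The power constraint is $\mathbb E\|x_1\|^2,\ \mathbb E\|x_2\|^2,\ \mathbb E\|x_R\|^2\le nP$, and $P_e=\Pr(\hat u_A\ne u_A\text{ or }\hat u_B\neq u_B)$. An exchange rate $R$ is achievable if there are schemes for $n=0,1,2,\dots$ with message lengths $k_n$, satisfying the power constraint, such that $k_n/n\to R$ and $P_e\to0$. The exchange capacity $C_{ex}(P,\sigma)$ is the supremum of all achievable exchange rates. **Time-shared joint decoding scheme.** No random seed is used. In the multiple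 access phase $A$ transmits only in the first $\lfloor n/2\rfloor$ uses and $B$ only in the next $\lfloor n/2\rfloor$ uses, each with average power at most $2P$ over its uses. The relay decodes both messages from $y_R$, with error probability tending to $0$, and sends an encoding of the XOR of the two decoded messages. Each terminal decodes this XOR from its received signal and adds its own message (XOR) to recover the other message. The power constraint, $P_e\to 0$ and $k_n/n\to R$ are as above. **Claim.** For all $P>0$ and $\sigma>0$, with logarithms to base $2$: 1. The largest exchange rate that is achieved by the time-shared joint decoding scheme exists and equals $$R_{ex,JD}(P,\sigma)=\tfrac14\log_2\!\Big(1+\frac{2P}{\sigma^2}\Big);$$ in particular this is an achievable exchange rate. 2. Every achievable exchange rate is at most $\tfrac12\log_2\big(1+\tfrac{P}{\sigma^2}\big)$. Moreover the scheme is asymptotically optimal at low SNR: as $P/\sigma^2\to0$ (with $P,\sigma>0$), $$\frac{R_{ex,JD}(P,\sigma)}{C_{ex}(P,\sigma)}\to1\qquad\text{and}\qquad\frac{R_{ex,JD}(P,\sigma)}{\tfrac12\log_2(1+P/\sigma^2)}\to1 .$$ -/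

import Mathlib

open MeasureTheory ProbabilityTheory Filter Topology
open scoped ENNReal

noncomputable section

namespace BidirRelay

/-- Messages of `k` information bits. -/
abbrev Msg (k : ℕ) := Fin k → Bool

/-- Signals over `n` real channel uses. -/
abbrev Signal (n : ℕ) := Fin n → ℝ

/-- Bitwise XOR of two messages. -/
def bxor {k : ℕ} (u v : Msg k) : Msg k := fun i => xor (u i) (v i)

/-- The squared Euclidean norm of a signal. -/
def energy {n : ℕ} (x : Signal n) : ℝ := ∑ i, x i ^ 2

/-- The uniform distribution on messages of `k` bits. -/
def msgLaw (k : ℕ) : Measure (Msg k) := (PMF.uniformOfFintype (Msg k)).toMeasure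

/-- `n` i.i.d. Gaussian noise samples of mean `0` and variance `σ ^ 2`. -/
def noiseLaw (n : ℕ) (σ : ℝ) : Measure (Signal n) :=
  Measure.pi fun _ => gaussianReal 0 (σ ^ 2).toNNReal

/-- An arbitrary encoding/decoding scheme for exchanging `k`-bit messages with `n` uses of the
channel in the multiple access phase and `n` uses in the broadcast phase. All three nodes may use
a common random seed, which is independent of messages and noises (a dither is of this kind; a
deterministic code ignores the seed). A terminal decodes from its own message and the signal that
it receives in the broadcast phase. -/
structure Code (k n : ℕ) where
  seedLaw : ProbabilityMeasure ℝ
  encA : ℝ → Msg k → Signal n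
  encB : ℝ → Msg k → Signal n
  relay : ℝ → Signal n → Signal n
  decA : ℝ → Msg k → Signal n → Msg k
  decB : ℝ → Msg k → Signal n → Msg k
  measurable_encA : Measurable fun p : ℝ × Msg k => encA p.1 p.2
  measurable_encB : Measurable fun p : ℝ × Msg k => encB p.1 p.2
  measurable_relay : Measurable fun p : ℝ × Signal n => relay p.1 p.2
  measurable_decA : Measurable fun p : ℝ × Msg k × Signal n => decA p.1 p.2.1 p.2.2
  measurable_decB : Measurable fun p : ℝ × Msg k × Signal n => decB p.1 p.2.1 p.2.2

/-- Outcomes `(seed, (u_A, u_B), (z_R, z_A, z_B))`. -/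
abbrev Sample (k n : ℕ) := ℝ × (Msg k × Msg k) × (Signal n × Signal n × Signal n)

namespace Code

variable {k n : ℕ}

/-- The joint law: seed, messages and noises are independent, the messages are uniform and the
noises at the relay and at the two terminals are white Gaussian of variance `σ ^ 2`. -/
def law (c : Code k n) (σ : ℝ) : Measure (Sample k n) :=
  (c.seedLaw : Measure ℝ).prod
    (((msgLaw k).prod (msgLaw k)).prod
      ((noiseLaw n σ).prod ((noiseLaw n σ).prod (noiseLaw n σ))))

/-- The signal sent by terminal `A`. -/
def xA (c : Code k n) (ω : Sample k n) : Signal n := c.encA ω.1 ω.2.1.1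

/-- The signal sent by terminal `B`. -/
def xB (c : Code k n) (ω : Sample k n) : Signal n := c.encB ω.1 ω.2.1.2

/-- The signal received by the relay in the multiple access phase. -/
def yR (c : Code k n) (ω : Sample k n) : Signal n := c.xA ω + c.xB ω + ω.2.2.1

/-- The signal sent by the relay in the broadcast phase. -/
def xR (c : Code k n) (ω : Sample k n) : Signal n := c.relay ω.1 (c.yR ω)

/-- The signal received by terminal `A`. -/
def yA (c : Code k n) (ω : Sample k n) : Signal n := c.xR ω + ω.2.2.2.1

/-- The signal received by terminal `B`. -/
def yB (c : Code k n) (ω : Sample k n) : Signal n := c.xR ω + ω.2.2.2.2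

/-- The estimate of the message of `B` formed by terminal `A`. -/
def estB (c : Code k n) (ω : Sample k n) : Msg k := c.decA ω.1 ω.2.1.1 (c.yA ω)

/-- The estimate of the message of `A` formed by terminal `B`. -/
def estA (c : Code k n) (ω : Sample k n) : Msg k := c.decB ω.1 ω.2.1.2 (c.yB ω)

/-- The probability that at least one of the two terminals errs. -/
def errorProb (c : Code k n) (σ : ℝ) : ℝ≥0∞ :=
  c.law σ {ω | c.estA ω ≠ ω.2.1.1 ∨ c.estB ω ≠ ω.2.1.2}

/-- The expected energy of the transmitted signal `x`. -/
def meanEnergy (c : Code k n) (σ : ℝ) (x : Sample k n → Signal n) : ℝ≥0∞ :=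
  ∫⁻ ω, ENNReal.ofReal (energy (x ω)) ∂c.law σ

/-- The average power of each of the three transmitters is at most `P`. -/
def PowerConstraint (c : Code k n) (P σ : ℝ) : Prop :=
  c.meanEnergy σ c.xA ≤ ENNReal.ofReal (n * P) ∧
  c.meanEnergy σ c.xB ≤ ENNReal.ofReal (n * P) ∧
  c.meanEnergy σ c.xR ≤ ENNReal.ofReal (n * P)

end Code

/-- The exchange rate `R` (in bits per channel use) is achievable by some sequence of codes. -/
def Achievable (P σ R : ℝ) : Prop :=
  ∃ (k : ℕ → ℕ) (c : ∀ n, Code (k n) n),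
    (∀ n, (c n).PowerConstraint P σ) ∧
    Tendsto (fun n => (c n).errorProb σ) atTop (𝓝 0) ∧
    Tendsto (fun n => (k n : ℝ) / n) atTop (𝓝 R)

/-- The exchange capacity: the supremum of the achievable exchange rates. -/
def exchangeCapacity (P σ : ℝ) : ℝ := sSup {R | Achievable P σ R}

/-- A (deterministic) joint decoding code with a time-shared multiple access phase. Terminal `A`
is silent except in the first `⌊n/2⌋` channel uses, terminal `B` except in the next `⌊n/2⌋`.
The relay decodes both messages, and encodes the XOR of its two decisions. Each terminal
decodes the XOR from what it receives. -/
structure JDCode (k n : ℕ) where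
  encA : Msg k → Signal n
  encB : Msg k → Signal n
  relayDec : Signal n → Msg k × Msg k
  relayEnc : Msg k → Signal n
  xorDecA : Signal n → Msg k
  xorDecB : Signal n → Msg k
  silentA : ∀ u (i : Fin n), n / 2 ≤ (i : ℕ) → encA u i = 0
  silentB : ∀ u (i : Fin n), ((i : ℕ) < n / 2 ∨ 2 * (n / 2) ≤ (i : ℕ)) → encB u i = 0
  measurable_relayDec : Measurable relayDec
  measurable_xorDecA : Measurable xorDecA
  measurable_xorDecB : Measurable xorDecB

namespace JDCode

variable {k n : ℕ}

/-- The scheme that a joint decoding code describes. Each terminal adds its own message to the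
XOR that it has decoded, to recover the message of the other terminal. -/
def toCode (c : JDCode k n) : Code k n where
  seedLaw := ⟨Measure.dirac 0, inferInstance⟩
  encA _ u := c.encA u
  encB _ u := c.encB u
  relay _ y := c.relayEnc (bxor (c.relayDec y).1 (c.relayDec y).2)
  decA _ u y := bxor u (c.xorDecA y)
  decB _ u y := bxor u (c.xorDecB y)
  measurable_encA := (Measurable.of_discrete (f := c.encA)).comp measurable_snd
  measurable_encB := (Measurable.of_discrete (f := c.encB)).comp measurable_snd
  measurable_relay :=
    (Measurable.of_discrete (f := fun p : Msg k × Msg k => c.relayEnc (bxor p.1 p.2))).comp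
      (c.measurable_relayDec.comp measurable_snd)
  measurable_decA :=
    (Measurable.of_discrete (f := fun p : Msg k × Msg k => bxor p.1 p.2)).comp
      ((measurable_fst.comp measurable_snd).prodMk
        (c.measurable_xorDecA.comp (measurable_snd.comp measurable_snd)))
  measurable_decB :=
    (Measurable.of_discrete (f := fun p : Msg k × Msg k => bxor p.1 p.2)).comp
      ((measurable_fst.comp measurable_snd).prodMk
        (c.measurable_xorDecB.comp (measurable_snd.comp measurable_snd)))

/-- The probability that the relay does not decode both messages correctly. -/
def relayErrorProb (c : JDCode k n) (σ : ℝ) : ℝ≥0∞ :=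
  c.toCode.law σ {ω | c.relayDec (c.toCode.yR ω) ≠ ω.2.1}

/-- Besides the power constraint `P` over the whole block at all three nodes, each terminal has
average power at most `2 P` over the `⌊n/2⌋` channel uses that belong to it. -/
def PowerConstraint (c : JDCode k n) (P σ : ℝ) : Prop :=
  c.toCode.PowerConstraint P σ ∧
  c.toCode.meanEnergy σ c.toCode.xA ≤ ENNReal.ofReal ((n / 2 : ℕ) * (2 * P)) ∧
  c.toCode.meanEnergy σ c.toCode.xB ≤ ENNReal.ofReal ((n / 2 : ℕ) * (2 * P))

end JDCode

/-- The exchange rate `R` (in bits per channel use) is achievable by joint decoding with a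
time-shared multiple access phase: the relay reliably decodes both messages, and the terminals
reliably recover each other's message. -/
def JDAchievable (P σ R : ℝ) : Prop :=
  ∃ (k : ℕ → ℕ) (c : ∀ n, JDCode (k n) n),
    (∀ n, (c n).PowerConstraint P σ) ∧
    Tendsto (fun n => (c n).relayErrorProb σ) atTop (𝓝 0) ∧
    Tendsto (fun n => (c n).toCode.errorProb σ) atTop (𝓝 0) ∧
    Tendsto (fun n => (k n : ℝ) / n) atTop (𝓝 R)

/-- The rate `¼ log₂ (1 + 2 P / σ²)`. -/
def jdRate (P σ : ℝ) : ℝ := 1 / 4 * Real.logb 2 (1 + 2 * P / σ ^ 2)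

/-- The cut-set bound `½ log₂ (1 + P / σ²)`. -/
def upperBound (P σ : ℝ) : ℝ := 1 / 2 * Real.logb 2 (1 + P / σ ^ 2)

/-- The regime of powers `P > 0` and noise levels `σ > 0` with `P / σ ^ 2 → 0`. -/
def lowSNR : Filter (ℝ × ℝ) :=
  comap (fun p => p.1 / p.2 ^ 2) (𝓝 0) ⊓ 𝓟 {p | 0 < p.1 ∧ 0 < p.2}

end BidirRelay

end

/-! The two claims about rates are a converse and an achievability theorem for the Gaussian channel,
each in a form that needs neither entropy nor mutual information.

**Converse.** Both upper bounds come from the cut around terminal `A`. Given the seed, the message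
of `B` and the noises of the broadcast phase, the estimate of `u_A` is a function of `x_A + z_R`,
so `u_A` is sent over a point-to-point Gaussian channel. For such a channel let `i` be the
log-likelihood ratio (`infoDensity`) between the channel output and a fixed product Gaussian law
with coordinate variances `σ² + P i`. Under that law the output is independent of the message, so
that the message is guessed correctly with probability `2 ^ (-k)` only; changing the measure back
gives `E exp (k log 2 · 1[correct] - i) ≤ 2` (`lintegral_exp_sub_infoDensity_le`). Then
`1 + t ≤ exp t` turns this into a bound on `k` that is linear in the error probability and in the
energy of the codewords (`single_user_converse`): it is the tangent line of the logarithm at the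
allowed power. Being linear, it can be averaged over everything that was conditioned on
(`Code.converse`). With `P i = P` everywhere it gives the cut-set bound; with `P i = 2 P` on the
first half of the block and `0` elsewhere it gives the bound for time-shared schemes.

**Achievability.** Feinstein's maximal code construction (`exists_maximal_code`) with a Gaussian
input of slightly less than the allowed power gives codes in which every codeword satisfies the
power constraint and every message has a small error probability
(`eventually_exists_gaussian_code`). An output explains a codeword if the noise is not too strong
and the output is not too weak; Chebyshev's inequality shows that this holds for the true codeword,
and the same change of measure shows that it is exponentially unlikely for an independent one.
One such code is used by both terminals in their halves of the multiple access phase, at power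
`2 P`, and another one by the relay for the XOR, at power `P`. The second one is not the bottleneck
because `1 + 2 x ≤ (1 + x) ^ 2`. The rate `jdRate` itself, and not only every smaller rate, is
attained by choosing at each block length a code that is nearly the best one
(`jdAchievable_jdRate`).

**Low SNR.** Both `log (1 + 2 x) / 4` and `log (1 + x) / 2` are `x / 2 + o(x)`, and the exchange
capacity lies between the two rates. -/

noncomputable section

namespace BidirRelay

/-! ### Product measures and Gaussian vectors -/

/-- Tonelli's theorem for a product of functions of separate coordinates. -/
lemma lintegral_pi_prod {n : ℕ} (μ : Fin n → Measure ℝ) [∀ i, SigmaFinite (μ i)]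
    (f : Fin n → ℝ → ℝ≥0∞) (hf : ∀ i, Measurable (f i)) :
    ∫⁻ x, ∏ i, f i (x i) ∂Measure.pi μ = ∏ i, ∫⁻ t, f i t ∂μ i := by
  induction n with
  | zero => simp
  | succ n ih =>
    rw [← (measurePreserving_piFinSuccAbove μ 0).symm.lintegral_comp_emb
      (MeasurableEquiv.measurableEmbedding _)]
    simp only [MeasurableEquiv.piFinSuccAbove_symm_apply, Fin.insertNthEquiv,
      Fin.prod_univ_succ, Fin.insertNth_zero, Equiv.coe_fn_mk, Fin.cons_succ, Fin.cons_zero,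
      Fin.zero_succAbove, cast_eq]
    have := lintegral_prod_mul (μ := μ 0) (ν := Measure.pi fun j : Fin n => μ j.succ)
      (f := f 0) (g := fun x => ∏ i, f i.succ (x i)) (hf 0).aemeasurable ?_
    · rw [ih _ _ fun i => hf _] at this
      exact this
    exact (Finset.measurable_prod _ fun i _ => (hf _).comp (measurable_pi_apply i)).aemeasurable

lemma pi_withDensity {n : ℕ} (μ : Fin n → Measure ℝ) [∀ i, SigmaFinite (μ i)]
    (f : Fin n → ℝ → ℝ≥0∞) (hf : ∀ i, Measurable (f i))
    [∀ i, SigmaFinite ((μ i).withDensity (f i))] :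
    Measure.pi (fun i => (μ i).withDensity (f i)) =
      (Measure.pi μ).withDensity fun x => ∏ i, f i (x i) := by
  refine Measure.pi_eq fun s hs => ?_
  rw [withDensity_apply _ (MeasurableSet.univ_pi hs),
    ← lintegral_indicator (MeasurableSet.univ_pi hs)]
  have : ∀ x : Fin n → ℝ, (Set.univ.pi s).indicator (fun x => ∏ i, f i (x i)) x =
      ∏ i, (s i).indicator (f i) (x i) := by
    intro x
    by_cases hx : x ∈ Set.univ.pi s
    · rw [Set.indicator_of_mem hx]
      exact Finset.prod_congr rfl fun i _ => by rw [Set.indicator_of_mem (hx i trivial)]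
    · rw [Set.indicator_of_notMem hx]
      simp only [Set.mem_pi, Set.mem_univ, true_imp_iff, not_forall] at hx
      obtain ⟨i, hi⟩ := hx
      exact (Finset.prod_eq_zero (Finset.mem_univ i) (Set.indicator_of_notMem hi _)).symm
  simp_rw [this]
  rw [lintegral_pi_prod _ _ fun i => (hf i).indicator (hs i)]
  exact Finset.prod_congr rfl fun i _ => by
    rw [withDensity_apply _ (hs i), lintegral_indicator (hs i)]

/-- The law of a vector of independent centred Gaussian coordinates with variances `v`. -/
def gaussianVector {n : ℕ} (v : Fin n → ℝ) : Measure (Signal n) :=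
  Measure.pi fun i => gaussianReal 0 (v i).toNNReal

instance {n : ℕ} (v : Fin n → ℝ) : IsProbabilityMeasure (gaussianVector v) := by
  unfold gaussianVector; infer_instance

lemma noiseLaw_eq (n : ℕ) (σ : ℝ) : noiseLaw n σ = gaussianVector fun _ => σ ^ 2 := rfl

instance (n : ℕ) (σ : ℝ) : IsProbabilityMeasure (noiseLaw n σ) := by
  rw [noiseLaw_eq]; infer_instance

instance (k : ℕ) : IsProbabilityMeasure (msgLaw k) := by
  unfold msgLaw; infer_instance

lemma gaussianVector_eq_withDensity {n : ℕ} {v : Fin n → ℝ} (hv : ∀ i, 0 < v i) :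
    gaussianVector v =
      (volume : Measure (Signal n)).withDensity
        fun x => ∏ i, gaussianPDF 0 (v i).toNNReal (x i) := by
  have h : ∀ i, gaussianReal 0 (v i).toNNReal =
      (volume : Measure ℝ).withDensity (gaussianPDF 0 (v i).toNNReal) := fun i =>
    gaussianReal_of_var_ne_zero _ (by simpa using hv i)
  have : ∀ i, SigmaFinite ((volume : Measure ℝ).withDensity (gaussianPDF 0 (v i).toNNReal)) :=
    fun i => by rw [← h i]; infer_instance
  unfold gaussianVector
  simp_rw [h]
  exact pi_withDensity _ _ fun i => measurable_gaussianPDF _ _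

/-- The log-likelihood ratio, at the output `x + z`, between the channel with input `x` and noise
`z` of variance `σ ^ 2`, and a centred Gaussian output with variances `σ ^ 2 + P i`. -/
def infoDensity {n : ℕ} (σ : ℝ) (P : Fin n → ℝ) (x z : Signal n) : ℝ :=
  ∑ i, (1 / 2 * Real.log ((σ ^ 2 + P i) / σ ^ 2) + (x i + z i) ^ 2 / (2 * (σ ^ 2 + P i)) -
    z i ^ 2 / (2 * σ ^ 2))

lemma measurable_infoDensity {n : ℕ} (σ : ℝ) (P : Fin n → ℝ) (x : Signal n) :
    Measurable (infoDensity σ P x) := by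
  unfold infoDensity; fun_prop

lemma gaussianPDF_eq_mul {s τ x z : ℝ} (hs : 0 < s) (hτ : 0 < τ) :
    gaussianPDF 0 τ.toNNReal (x + z) = gaussianPDF 0 s.toNNReal z *
      ENNReal.ofReal (Real.exp (-(1 / 2 * Real.log (τ / s) + (x + z) ^ 2 / (2 * τ) -
        z ^ 2 / (2 * s)))) := by
  rw [gaussianPDF, gaussianPDF, ← ENNReal.ofReal_mul (gaussianPDFReal_nonneg _ _ _)]
  congr 1
  have hπ := Real.pi_pos
  have h1 : Real.sqrt τ ≠ 0 := (Real.sqrt_pos.2 hτ).ne'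
  have h2 : Real.sqrt s ≠ 0 := (Real.sqrt_pos.2 hs).ne'
  have hlog : Real.exp (-(1 / 2 * Real.log (τ / s))) = Real.sqrt s / Real.sqrt τ := by
    rw [show -(1 / 2 * Real.log (τ / s)) = Real.log (s / τ) * (1 / 2) by
      rw [← inv_div s τ, Real.log_inv]; ring]
    rw [← Real.rpow_def_of_pos (by positivity), ← Real.sqrt_eq_rpow, Real.sqrt_div hs.le]
  rw [gaussianPDFReal, gaussianPDFReal, Real.coe_toNNReal _ hs.le, Real.coe_toNNReal _ hτ.le,
    show -(1 / 2 * Real.log (τ / s) + (x + z) ^ 2 / (2 * τ) - z ^ 2 / (2 * s)) =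
      -(1 / 2 * Real.log (τ / s)) + (-(x + z - 0) ^ 2 / (2 * τ)) - (-(z - 0) ^ 2 / (2 * s)) by ring,
    Real.exp_sub, Real.exp_add, hlog, Real.sqrt_mul (by positivity) τ,
    Real.sqrt_mul (by positivity) s]
  have := (Real.exp_pos (-(z - 0) ^ 2 / (2 * s))).ne'
  field_simp

/-- Change of measure from the Gaussian output law to the channel output with input `x`. -/
lemma lintegral_gaussianVector {n : ℕ} {σ : ℝ} (hσ : 0 < σ) {P : Fin n → ℝ} (hP : ∀ i, 0 ≤ P i)
    (x : Signal n) {f : Signal n → ℝ≥0∞} (hf : Measurable f) :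
    ∫⁻ y, f y ∂gaussianVector (fun i => σ ^ 2 + P i) =
      ∫⁻ z, f (x + z) * ENNReal.ofReal (Real.exp (-infoDensity σ P x z)) ∂noiseLaw n σ := by
  have hs : 0 < σ ^ 2 := by positivity
  have hτ : ∀ i, 0 < σ ^ 2 + P i := fun i => add_pos_of_pos_of_nonneg hs (hP i)
  have hm : ∀ v : Fin n → ℝ,
      Measurable fun x : Signal n => ∏ i, gaussianPDF 0 (v i).toNNReal (x i) := fun v =>
    Finset.measurable_prod _ fun i _ =>
      (measurable_gaussianPDF _ _).comp (measurable_pi_apply i)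
  have hx : Measurable fun z : Signal n => x + z := by fun_prop
  have he : Measurable fun z => ENNReal.ofReal (Real.exp (-infoDensity σ P x z)) :=
    ((measurable_infoDensity σ P x).neg.exp).ennreal_ofReal
  rw [noiseLaw_eq, gaussianVector_eq_withDensity hτ, gaussianVector_eq_withDensity fun _ => hs,
    lintegral_withDensity_eq_lintegral_mul _ (hm _) hf,
    lintegral_withDensity_eq_lintegral_mul _ (hm _)
      (show Measurable fun z => f (x + z) * ENNReal.ofReal (Real.exp (-infoDensity σ P x z)) from
        (hf.comp hx).mul he),
    ← lintegral_add_left_eq_self _ x]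
  refine lintegral_congr fun z => ?_
  simp only [Pi.mul_apply, Pi.add_apply]
  rw [mul_left_comm, mul_comm (∏ i, _)]
  congr 1
  rw [infoDensity, ← Finset.sum_neg_distrib, Real.exp_sum,
    ENNReal.ofReal_prod_of_nonneg fun i _ => (Real.exp_pos _).le, ← Finset.prod_mul_distrib]
  exact Finset.prod_congr rfl fun i _ => gaussianPDF_eq_mul hs (hτ i)

lemma memLp_sq_gaussianReal (v : NNReal) : MemLp (fun t : ℝ => t ^ 2) 2 (gaussianReal 0 v) := by
  have h := (memLp_id_gaussianReal' (μ := 0) (v := v) 4 (by simp))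
  have h2 := h.norm_rpow_div 2
  rw [show (4 : ℝ≥0∞) / 2 = 2 by
    rw [show (4 : ℝ≥0∞) = 2 * 2 by norm_num, mul_div_assoc, ENNReal.div_self (by simp) (by simp),
      mul_one]] at h2
  simpa using h2

lemma integral_sq_gaussianReal (v : NNReal) : ∫ t, t ^ 2 ∂gaussianReal 0 v = v := by
  have := variance_of_integral_eq_zero (X := fun t : ℝ => t) (μ := gaussianReal 0 v)
    (by fun_prop) (by simp)
  rw [← this, variance_fun_id_gaussianReal]

/-- The weak law of large numbers for the energy of a white Gaussian vector, from Chebyshev's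
inequality. -/
lemma exists_energy_deviation_le (v : ℝ) (hv : 0 ≤ v) : ∃ C : ℝ, ∀ (n : ℕ) (δ : ℝ), 0 < δ → 0 < n →
    gaussianVector (fun _ : Fin n => v) {z | n * δ ≤ |energy z - n * v|} ≤
      ENNReal.ofReal (C / (n * δ ^ 2)) := by
  refine ⟨Var[fun t : ℝ => t ^ 2; gaussianReal 0 v.toNNReal], fun n δ hδ hn => ?_⟩
  have hL := memLp_sq_gaussianReal v.toNNReal
  have hi : ∀ i : Fin n, MemLp (fun z : Signal n => z i ^ 2) 2 (gaussianVector fun _ => v) :=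
    fun i => hL.comp_measurePreserving
      (measurePreserving_eval (fun _ : Fin n => gaussianReal 0 v.toNNReal) i)
  have hE : MemLp (fun z : Signal n => energy z) 2 (gaussianVector fun _ => v) := by
    unfold energy
    exact memLp_finsetSum _ fun i _ => hi i
  have hmean : ∫ z, energy z ∂gaussianVector (fun _ : Fin n => v) = n * v := by
    unfold energy
    rw [integral_finsetSum _ fun i _ => (hi i).integrable (by norm_num)]
    have : ∀ i : Fin n, ∫ z : Signal n, z i ^ 2 ∂gaussianVector (fun _ => v) = v := fun i => by
      unfold gaussianVector
      rw [integral_comp_eval (μ := fun _ : Fin n => gaussianReal 0 v.toNNReal)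
        (f := fun t : ℝ => t ^ 2) (by fun_prop), integral_sq_gaussianReal, Real.coe_toNNReal _ hv]
    simp [this]
  have hvar : Var[fun z : Signal n => energy z; gaussianVector fun _ => v] =
      n * Var[fun t : ℝ => t ^ 2; gaussianReal 0 v.toNNReal] := by
    have := variance_sum_pi (μ := fun _ : Fin n => gaussianReal 0 v.toNNReal)
      (X := fun _ t => t ^ 2) fun _ => hL
    simp only [Finset.sum_const, Finset.card_univ, Fintype.card_fin, nsmul_eq_mul] at this
    rw [← this]
    congr 1
    ext z
    simp [energy]
  have hn' : (0 : ℝ) < n := by exact_mod_cast hn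
  have := meas_ge_le_variance_div_sq hE (mul_pos hn' hδ)
  rw [hmean, hvar] at this
  refine this.trans (ENNReal.ofReal_le_ofReal (le_of_eq ?_))
  field_simp

/-- The sum of independent Gaussian vectors is Gaussian and the variances add. -/
lemma map_add_gaussianVector {n : ℕ} {v w : Fin n → ℝ} (hv : ∀ i, 0 ≤ v i) (hw : ∀ i, 0 ≤ w i) :
    ((gaussianVector v).prod (gaussianVector w)).map (fun p => p.1 + p.2) =
      gaussianVector fun i => v i + w i := by
  unfold gaussianVector
  rw [← (measurePreserving_arrowProdEquivProdArrow ℝ ℝ (Fin n)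
    (fun i => gaussianReal 0 (v i).toNNReal) fun i => gaussianReal 0 (w i).toNNReal).map_eq,
    Measure.map_map (by fun_prop) (MeasurableEquiv.measurable _)]
  have : ((fun p : Signal n × Signal n => p.1 + p.2) ∘
      MeasurableEquiv.arrowProdEquivProdArrow ℝ ℝ (Fin n)) =
      fun q i => (fun t : ℝ × ℝ => t.1 + t.2) (q i) := rfl
  have hp : ∀ i, IsProbabilityMeasure (((gaussianReal 0 (v i).toNNReal).prod
      (gaussianReal 0 (w i).toNNReal)).map fun t : ℝ × ℝ => t.1 + t.2) := fun i =>
    Measure.isProbabilityMeasure_map (by fun_prop)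
  rw [this, Measure.pi_map_pi (f := fun _ (t : ℝ × ℝ) => t.1 + t.2) fun i => by fun_prop]
  congr 1
  ext1 i
  have h := gaussianReal_conv_gaussianReal (m₁ := 0) (m₂ := 0) (v₁ := (v i).toNNReal)
    (v₂ := (w i).toNNReal)
  rw [Measure.conv, add_zero] at h
  rw [h, Real.toNNReal_add (hv i) (hw i)]

/-! ### The converse for a point-to-point Gaussian channel -/

lemma ofReal_integral_le_lintegral_ofReal {α : Type*} [MeasurableSpace α] {μ : Measure α}
    (f : α → ℝ) : ENNReal.ofReal (∫ a, f a ∂μ) ≤ ∫⁻ a, ENNReal.ofReal (f a) ∂μ := by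
  by_cases hf : Integrable f μ
  · rw [integral_eq_lintegral_pos_part_sub_lintegral_neg_part hf]
    exact (ENNReal.ofReal_le_ofReal (sub_le_self _ ENNReal.toReal_nonneg)).trans
      ENNReal.ofReal_toReal_le
  · simp [integral_undef hf]

lemma msgLaw_singleton {k : ℕ} (u : Msg k) : msgLaw k {u} = (2 ^ k)⁻¹ := by
  rw [msgLaw, PMF.toMeasure_apply_singleton _ _ (measurableSet_singleton _)]
  simp

lemma integrable_infoDensity_term (s τ c x : ℝ) (v : NNReal) :
    Integrable (fun t : ℝ => c + (x + t) ^ 2 / (2 * τ) - t ^ 2 / (2 * s)) (gaussianReal 0 v) := by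
  have h2 : Integrable (fun t : ℝ => t ^ 2) (gaussianReal 0 v) :=
    (memLp_sq_gaussianReal v).integrable (by norm_num)
  have h1 : Integrable (fun t : ℝ => t) (gaussianReal 0 v) :=
    (memLp_id_gaussianReal' 1 (by simp)).integrable (by norm_num)
  have h3 : Integrable (fun t : ℝ => x ^ 2 + 2 * x * t + t ^ 2) (gaussianReal 0 v) :=
    ((integrable_const _).add (h1.const_mul _)).add h2
  refine ((integrable_const c).add ?_).sub (h2.div_const _)
  refine (h3.congr (ae_of_all _ fun t => ?_)).div_const (2 * τ)
  ring

lemma integral_infoDensity_term {s τ : ℝ} (hs : 0 < s) (c x : ℝ) :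
    ∫ t, (c + (x + t) ^ 2 / (2 * τ) - t ^ 2 / (2 * s)) ∂gaussianReal 0 s.toNNReal =
      c + (x ^ 2 + s) / (2 * τ) - 1 / 2 := by
  set γ := gaussianReal 0 s.toNNReal
  have h2 : Integrable (fun t : ℝ => t ^ 2) γ :=
    (memLp_sq_gaussianReal _).integrable (by norm_num)
  have h1 : Integrable (fun t : ℝ => t) γ :=
    (memLp_id_gaussianReal' 1 (by simp)).integrable (by norm_num)
  have e : ∀ t : ℝ, c + (x + t) ^ 2 / (2 * τ) - t ^ 2 / (2 * s) =
      (c + x ^ 2 / (2 * τ)) + (x / τ) * t + (1 / (2 * τ) - 1 / (2 * s)) * t ^ 2 := fun t => by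
    rcases eq_or_ne τ 0 with rfl | hτ
    · simp; ring
    · field_simp; ring
  simp_rw [e]
  have h3 : Integrable (fun t : ℝ => (c + x ^ 2 / (2 * τ)) + (x / τ) * t) γ :=
    (integrable_const _).add (h1.const_mul _)
  rw [integral_add h3 (h2.const_mul _), integral_add (integrable_const _) (h1.const_mul _),
    integral_const_mul, integral_const_mul,
    integral_sq_gaussianReal, integral_id_gaussianReal, Real.coe_toNNReal _ hs.le]
  simp
  field_simp
  ring

lemma integrable_infoDensity {n : ℕ} (σ : ℝ) (P : Fin n → ℝ) (x : Signal n) :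
    Integrable (infoDensity σ P x) (noiseLaw n σ) := by
  unfold infoDensity
  refine integrable_finsetSum _ fun i _ => ?_
  exact integrable_comp_eval (μ := fun _ : Fin n => gaussianReal 0 (σ ^ 2).toNNReal) (i := i)
        (integrable_infoDensity_term (σ ^ 2) (σ ^ 2 + P i)
          (1 / 2 * Real.log ((σ ^ 2 + P i) / σ ^ 2)) (x i) _)

/-- The relative entropy between the channel output with input `x` and the Gaussian output law. -/
lemma integral_infoDensity {n : ℕ} {σ : ℝ} (hσ : 0 < σ) {P : Fin n → ℝ} (hP : ∀ i, 0 ≤ P i)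
    (x : Signal n) :
    ∫ z, infoDensity σ P x z ∂noiseLaw n σ =
      ∑ i, 1 / 2 * Real.log ((σ ^ 2 + P i) / σ ^ 2) + ∑ i, x i ^ 2 / (2 * (σ ^ 2 + P i)) -
        ∑ i, P i / (2 * (σ ^ 2 + P i)) := by
  have hs : 0 < σ ^ 2 := by positivity
  unfold infoDensity
  rw [integral_finsetSum]
  · rw [← Finset.sum_add_distrib, ← Finset.sum_sub_distrib]
    refine Finset.sum_congr rfl fun i _ => ?_
    have := integral_comp_eval (μ := fun _ : Fin n => gaussianReal 0 (σ ^ 2).toNNReal) (i := i)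
      (integrable_infoDensity_term (σ ^ 2) (σ ^ 2 + P i)
        (1 / 2 * Real.log ((σ ^ 2 + P i) / σ ^ 2)) (x i) _).aestronglyMeasurable
    rw [noiseLaw, this, integral_infoDensity_term hs]
    have : σ ^ 2 + P i ≠ 0 := (add_pos_of_pos_of_nonneg hs (hP i)).ne'
    field_simp
    ring
  · exact fun i _ =>
      integrable_comp_eval (μ := fun _ : Fin n => gaussianReal 0 (σ ^ 2).toNNReal) (i := i)
        (integrable_infoDensity_term (σ ^ 2) (σ ^ 2 + P i)
          (1 / 2 * Real.log ((σ ^ 2 + P i) / σ ^ 2)) (x i) _)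

/-- Weighted by the likelihood ratio to the output law, guessing a uniform message is no better
than at random: this is where the decoding regions are used. -/
lemma lintegral_exp_sub_infoDensity_le {k n : ℕ} {σ : ℝ} (hσ : 0 < σ) {P : Fin n → ℝ}
    (hP : ∀ i, 0 ≤ P i) (x : Msg k → Signal n) {g : Signal n → Msg k} (hg : Measurable g) :
    ∫⁻ u, ∫⁻ z, ENNReal.ofReal (Real.exp ((if g (x u + z) = u then k * Real.log 2 else 0) -
      infoDensity σ P (x u) z)) ∂noiseLaw n σ ∂msgLaw k ≤ 2 := by
  have hset : ∀ u, MeasurableSet {y | g y = u} := fun u => hg (measurableSet_singleton u)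
  have hmeas : ∀ u, Measurable fun y => if g y = u then (2 : ℝ≥0∞) ^ k else 1 := fun u =>
    Measurable.ite (hset u) measurable_const measurable_const
  have h1 : ∀ u, ∫⁻ z, ENNReal.ofReal (Real.exp ((if g (x u + z) = u then k * Real.log 2 else 0) -
      infoDensity σ P (x u) z)) ∂noiseLaw n σ =
      ∫⁻ y, (if g y = u then (2 : ℝ≥0∞) ^ k else 1) ∂gaussianVector fun i => σ ^ 2 + P i := by
    intro u
    rw [lintegral_gaussianVector hσ hP (x u) (hmeas u)]
    refine lintegral_congr fun z => ?_
    rw [sub_eq_add_neg, Real.exp_add, ENNReal.ofReal_mul (Real.exp_pos _).le]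
    congr 1
    split_ifs
    · rw [mul_comm, ← Real.rpow_def_of_pos two_pos, Real.rpow_natCast,
        ENNReal.ofReal_pow zero_le_two]
      simp
    · simp
  simp_rw [h1]
  rw [lintegral_lintegral_swap]
  · calc _ ≤ ∫⁻ _, 2 ∂gaussianVector fun i => σ ^ 2 + P i := by
          refine lintegral_mono fun y => ?_
          calc ∫⁻ u, (if g y = u then (2 : ℝ≥0∞) ^ k else 1) ∂msgLaw k
              ≤ ∫⁻ u, (1 + ({g y} : Set (Msg k)).indicator (fun _ => 2 ^ k) u) ∂msgLaw k := by
                refine lintegral_mono fun u => ?_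
                by_cases h : g y = u <;> simp [h, Set.indicator]
            _ = 2 := by
                rw [lintegral_add_left measurable_const,
                  lintegral_indicator_const (measurableSet_singleton _), msgLaw_singleton,
                  ENNReal.mul_inv_cancel (by simp) (by simp)]
                simp [one_add_one_eq_two]
      _ = 2 := by simp
  · refine (measurable_from_prod_countable_right fun u => ?_).aemeasurable
    exact hmeas u

/-- A tangent-line form of the converse to Gaussian channel coding. It is linear in the energy and
in the error probability, so it may be averaged over further randomness. -/
lemma single_user_converse {k n : ℕ} {σ : ℝ} (hσ : 0 < σ) {P : Fin n → ℝ}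
    (hP : ∀ i, 0 ≤ P i) (x : Msg k → Signal n) {g : Signal n → Msg k} (hg : Measurable g) :
    k * Real.log 2 + ∑ i, P i / (2 * (σ ^ 2 + P i)) ≤
      Real.log 2 + ∑ i, 1 / 2 * Real.log ((σ ^ 2 + P i) / σ ^ 2) +
      k * Real.log 2 * ∫ u, (noiseLaw n σ).real {z | g (x u + z) ≠ u} ∂msgLaw k +
      ∫ u, ∑ i, x u i ^ 2 / (2 * (σ ^ 2 + P i)) ∂msgLaw k := by
  have hset : ∀ u, MeasurableSet {z | g (x u + z) ≠ u} := fun u =>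
    (hg.comp (measurable_const_add (x u))) (measurableSet_singleton u).compl
  set T : Msg k → Signal n → ℝ := fun u z =>
    (if g (x u + z) = u then k * Real.log 2 else 0) - infoDensity σ P (x u) z with hT
  have hTi : ∀ u, T u = fun z => k * Real.log 2 -
      {z | g (x u + z) ≠ u}.indicator (fun _ => k * Real.log 2) z - infoDensity σ P (x u) z := by
    intro u
    ext z
    by_cases h : g (x u + z) = u <;> simp [hT, h]
  have hI : ∀ u, Integrable ({z | g (x u + z) ≠ u}.indicator fun _ => k * Real.log 2)
      (noiseLaw n σ) := fun u => (integrable_const _).indicator (hset u)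
  have hint : ∀ u, Integrable (T u) (noiseLaw n σ) := fun u => by
    rw [hTi]
    exact ((integrable_const _).sub (hI u)).sub (integrable_infoDensity _ _ _)
  have hval : ∀ u, ∫ z, T u z ∂noiseLaw n σ = k * Real.log 2 -
      (noiseLaw n σ).real {z | g (x u + z) ≠ u} * (k * Real.log 2) -
      (∑ i, 1 / 2 * Real.log ((σ ^ 2 + P i) / σ ^ 2) + ∑ i, x u i ^ 2 / (2 * (σ ^ 2 + P i)) -
        ∑ i, P i / (2 * (σ ^ 2 + P i))) := fun u => by
    have hs : Integrable (fun z => k * Real.log 2 -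
        {z | g (x u + z) ≠ u}.indicator (fun _ => k * Real.log 2) z) (noiseLaw n σ) :=
      (integrable_const _).sub (hI u)
    rw [hTi, integral_sub hs (integrable_infoDensity _ _ _),
      integral_sub (integrable_const _) (hI u), integral_infoDensity hσ hP,
      integral_indicator_const _ (hset u)]
    simp
  -- `1 + t ≤ exp t` at `t = T - log 2`, integrated over the noise and the message
  have key : ENNReal.ofReal (∫ u, (1 + (∫ z, T u z ∂noiseLaw n σ - Real.log 2)) ∂msgLaw k) ≤ 1 := by
    calc _ ≤ ∫⁻ u, ENNReal.ofReal (1 + (∫ z, T u z ∂noiseLaw n σ - Real.log 2)) ∂msgLaw k :=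
          ofReal_integral_le_lintegral_ofReal _
      _ ≤ ∫⁻ u, ∫⁻ z, 2⁻¹ * ENNReal.ofReal (Real.exp (T u z)) ∂noiseLaw n σ ∂msgLaw k := by
          refine lintegral_mono fun u => ?_
          have : 1 + (∫ z, T u z ∂noiseLaw n σ - Real.log 2) =
              ∫ z, (1 + (T u z - Real.log 2)) ∂noiseLaw n σ := by
            have hs : Integrable (fun z => T u z - Real.log 2) (noiseLaw n σ) :=
              (hint u).sub (integrable_const _)
            rw [integral_add (integrable_const _) hs,
              integral_sub (hint u) (integrable_const _)]
            simp
          rw [this]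
          refine (ofReal_integral_le_lintegral_ofReal _).trans (lintegral_mono fun z => ?_)
          have h := Real.add_one_le_exp (T u z - Real.log 2)
          rw [Real.exp_sub, Real.exp_log two_pos] at h
          have h2 : (2 : ℝ≥0∞)⁻¹ = ENNReal.ofReal 2⁻¹ := by
            rw [ENNReal.ofReal_inv_of_pos two_pos]; simp
          rw [h2, ← ENNReal.ofReal_mul (by norm_num)]
          refine ENNReal.ofReal_le_ofReal ?_
          linarith
      _ = 2⁻¹ * ∫⁻ u, ∫⁻ z, ENNReal.ofReal (Real.exp (T u z)) ∂noiseLaw n σ ∂msgLaw k := by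
          simp_rw [lintegral_const_mul' (2 : ℝ≥0∞)⁻¹ _ (by simp)]
      _ ≤ 2⁻¹ * 2 := by gcongr; exact lintegral_exp_sub_infoDensity_le hσ hP x hg
      _ = 1 := ENNReal.inv_mul_cancel (by simp) (by simp)
  rw [ENNReal.ofReal_le_one] at key
  have hfin : ∀ f : Msg k → ℝ, Integrable f (msgLaw k) := fun f => Integrable.of_finite
  simp_rw [hval] at key
  have e : ∫ u, (1 + (k * Real.log 2 -
      (noiseLaw n σ).real {z | g (x u + z) ≠ u} * (k * Real.log 2) -
      (∑ i, 1 / 2 * Real.log ((σ ^ 2 + P i) / σ ^ 2) + ∑ i, x u i ^ 2 / (2 * (σ ^ 2 + P i)) -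
        ∑ i, P i / (2 * (σ ^ 2 + P i))) - Real.log 2)) ∂msgLaw k =
      1 + (k * Real.log 2 + ∑ i, P i / (2 * (σ ^ 2 + P i))) - (Real.log 2 +
        ∑ i, 1 / 2 * Real.log ((σ ^ 2 + P i) / σ ^ 2)) -
      k * Real.log 2 * ∫ u, (noiseLaw n σ).real {z | g (x u + z) ≠ u} ∂msgLaw k -
      ∫ u, ∑ i, x u i ^ 2 / (2 * (σ ^ 2 + P i)) ∂msgLaw k := by
    rw [← integral_const_mul, eq_sub_iff_add_eq, eq_sub_iff_add_eq, ← integral_add (hfin _) (hfin _),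
      ← integral_add (hfin _) (hfin _)]
    trans ∫ _, (1 + (k * Real.log 2 + ∑ i, P i / (2 * (σ ^ 2 + P i))) - (Real.log 2 +
        ∑ i, 1 / 2 * Real.log ((σ ^ 2 + P i) / σ ^ 2))) ∂msgLaw k
    · congr 1
      ext u
      ring
    · simp
  rw [e] at key
  linarith

/-! ### The converse for the exchange of messages -/

instance {k n : ℕ} (c : Code k n) (σ : ℝ) : IsProbabilityMeasure (c.law σ) := by
  unfold Code.law; infer_instance

/-- Integration over the message of `A` and the noise at the relay. -/
lemma measurable_lintegral_msg_noise {k n : ℕ} (σ : ℝ) {F : Sample k n → ℝ≥0∞}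
    (hF : Measurable F) :
    Measurable fun a : ℝ × Msg k × Signal n × Signal n =>
      ∫⁻ u, ∫⁻ z, F (a.1, (u, a.2.1), z, a.2.2) ∂noiseLaw n σ ∂msgLaw k := by
  have hG : Measurable fun p : (ℝ × Msg k × Signal n × Signal n) × Msg k × Signal n =>
      F (p.1.1, (p.2.1, p.1.2.1), p.2.2, p.1.2.2) := hF.comp (by fun_prop)
  have h := hG.lintegral_prod_right' (ν := (msgLaw k).prod (noiseLaw n σ))
  convert h using 2 with a
  exact (lintegral_prod (fun q : Msg k × Signal n => F (a.1, (q.1, a.2.1), q.2, a.2.2))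
    (hF.comp (by fun_prop)).aemeasurable).symm

/-- Fubini's theorem for the law of a code, with the message of `A` and the noise at the relay
integrated first. -/
lemma Code.lintegral_law {k n : ℕ} (c : Code k n) (σ : ℝ) {F : Sample k n → ℝ≥0∞}
    (hF : Measurable F) :
    ∫⁻ ω, F ω ∂c.law σ = ∫⁻ a : ℝ × Msg k × Signal n × Signal n,
      ∫⁻ u, ∫⁻ z, F (a.1, (u, a.2.1), z, a.2.2) ∂noiseLaw n σ ∂msgLaw k
        ∂(c.seedLaw : Measure ℝ).prod
          ((msgLaw k).prod ((noiseLaw n σ).prod (noiseLaw n σ))) := by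
  have hR := measurable_lintegral_msg_noise σ hF
  rw [Code.law, lintegral_prod _ hF.aemeasurable, lintegral_prod _ hR.aemeasurable]
  refine lintegral_congr fun s => ?_
  have hRs : Measurable fun q : Msg k × Signal n × Signal n =>
      ∫⁻ u, ∫⁻ z, F (s, (u, q.1), z, q.2) ∂noiseLaw n σ ∂msgLaw k :=
    hR.comp (by fun_prop : Measurable fun q : Msg k × Signal n × Signal n => (s, q))
  have hFs : Measurable fun q : (Msg k × Msg k) × Signal n × Signal n × Signal n => F (s, q) :=
    hF.comp (by fun_prop)
  rw [lintegral_prod _ hRs.aemeasurable, lintegral_prod _ hFs.aemeasurable]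
  have hs : Measurable fun p : Msg k × Msg k =>
      ∫⁻ q : Signal n × Signal n × Signal n, F (s, p, q)
        ∂(noiseLaw n σ).prod ((noiseLaw n σ).prod (noiseLaw n σ)) :=
    Measurable.of_discrete
  rw [lintegral_prod_symm _ hs.aemeasurable]
  refine lintegral_congr fun v => ?_
  have h3 : ∀ u : Msg k, ∫⁻ q : Signal n × Signal n × Signal n, F (s, (u, v), q)
        ∂(noiseLaw n σ).prod ((noiseLaw n σ).prod (noiseLaw n σ)) =
      ∫⁻ w, ∫⁻ z, F (s, (u, v), z, w) ∂noiseLaw n σ ∂(noiseLaw n σ).prod (noiseLaw n σ) :=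
    fun u => lintegral_prod_symm _ (hF.comp (by fun_prop)).aemeasurable
  simp_rw [h3]
  rw [lintegral_lintegral_swap]
  refine (measurable_from_prod_countable_right fun u => ?_).aemeasurable
  exact Measurable.lintegral_prod_left' (f := fun p : Signal n × Signal n × Signal n =>
    F (s, (u, v), p)) (hF.comp (by fun_prop))

lemma measurable_energy {n : ℕ} : Measurable (energy : Signal n → ℝ) := by
  unfold energy; fun_prop

lemma energy_nonneg {n : ℕ} (x : Signal n) : 0 ≤ energy x :=
  Finset.sum_nonneg fun _ _ => sq_nonneg _

lemma Code.measurable_xA {k n : ℕ} (c : Code k n) : Measurable c.xA :=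
  c.measurable_encA.comp (by fun_prop : Measurable fun ω : Sample k n => (ω.1, ω.2.1.1))

lemma Code.measurable_xB {k n : ℕ} (c : Code k n) : Measurable c.xB :=
  c.measurable_encB.comp (by fun_prop : Measurable fun ω : Sample k n => (ω.1, ω.2.1.2))

lemma Code.measurable_estA {k n : ℕ} (c : Code k n) : Measurable c.estA := by
  have hy : Measurable c.yR :=
    (c.measurable_xA.add c.measurable_xB).add (by fun_prop)
  have hx : Measurable c.xR := c.measurable_relay.comp (measurable_fst.prodMk hy)
  have hyB : Measurable c.yB := hx.add (by fun_prop)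
  exact c.measurable_decB.comp
    (measurable_fst.prodMk ((by fun_prop : Measurable fun ω : Sample k n => ω.2.1.2).prodMk hyB))

/-- The cut around terminal `A`: given the seed, the message of `B` and the noises in the broadcast
phase, the estimate of the message of `A` is a function of the output of a Gaussian channel whose
input is `x_A`. If that input uses only `m` channel uses, at power `p`, the rate is bounded by
the capacity of these. -/
lemma Code.converse {k n : ℕ} (c : Code k n) {σ p : ℝ} (hσ : 0 < σ) (hp : 0 ≤ p) {m : ℕ}
    (hm : m ≤ n) (hsilent : ∀ s u (i : Fin n), m ≤ (i : ℕ) → c.encA s u i = 0)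
    (hpow : c.meanEnergy σ c.xA ≤ ENNReal.ofReal (m * p)) :
    k * Real.log 2 ≤ Real.log 2 + m * (1 / 2 * Real.log (1 + p / σ ^ 2)) +
      k * Real.log 2 * (c.errorProb σ).toReal := by
  have hs : 0 < σ ^ 2 := by positivity
  have hl : 0 ≤ Real.log 2 := Real.log_nonneg one_le_two
  set P : Fin n → ℝ := fun i => if (i : ℕ) < m then p else 0 with hPdef
  have hP : ∀ i, 0 ≤ P i := fun i => by simp only [hPdef]; split_ifs <;> simp [hp]
  have hcard : ((Finset.univ : Finset (Fin n)).filter fun i : Fin n => (i : ℕ) < m).card = m := by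
    rw [Fin.card_filter_val_lt, min_eq_right hm]
  have hsum : ∀ f : ℝ → ℝ, f 0 = 0 → ∑ i, f (P i) = m * f p := fun f hf => by
    have : ∀ i : Fin n, f (P i) = if (i : ℕ) < m then f p else 0 := fun i => by
      simp only [hPdef]; split_ifs <;> simp [hf]
    simp_rw [this]
    rw [← Finset.sum_filter, Finset.sum_const, hcard, nsmul_eq_mul]
  have hen : ∀ s u, ∑ i, c.encA s u i ^ 2 / (2 * (σ ^ 2 + P i)) =
      energy (c.encA s u) / (2 * (σ ^ 2 + p)) := fun s u => by
    rw [energy, Finset.sum_div]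
    refine Finset.sum_congr rfl fun i _ => ?_
    by_cases h : (i : ℕ) < m
    · simp [hPdef, h]
    · simp [hsilent s u i (not_lt.1 h)]
  set w : ℝ := 1 / (2 * (σ ^ 2 + p)) with hw
  have hw0 : 0 ≤ w := by positivity
  set C : ℝ := Real.log 2 + m * (1 / 2 * Real.log (1 + p / σ ^ 2)) with hC
  have hC0 : 0 ≤ C := by
    have : 0 ≤ Real.log (1 + p / σ ^ 2) := Real.log_nonneg (by simp; positivity)
    positivity
  -- the channel seen by the message of `A`, given everything but that message and the relay noise
  have hcond : ∀ a : ℝ × Msg k × Signal n × Signal n,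
      ENNReal.ofReal (k * Real.log 2 + m * p * w) ≤ ENNReal.ofReal C +
        (ENNReal.ofReal (k * Real.log 2) * (∫⁻ u, ∫⁻ z, {ω | c.estA ω ≠ ω.2.1.1}.indicator 1
          ((a.1, (u, a.2.1), z, a.2.2) : Sample k n) ∂noiseLaw n σ ∂msgLaw k) +
        ENNReal.ofReal w * ∫⁻ u, ∫⁻ z, ENNReal.ofReal (energy (c.xA
          ((a.1, (u, a.2.1), z, a.2.2) : Sample k n))) ∂noiseLaw n σ ∂msgLaw k) := by
    rintro ⟨s, v, zA, zB⟩
    set g : Signal n → Msg k := fun y =>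
      c.decB s v (c.relay s (y + c.encB s v) + zB) with hg
    have hgm : Measurable g := by
      have h1 : Measurable fun y : Signal n => c.relay s (y + c.encB s v) :=
        c.measurable_relay.comp (by fun_prop : Measurable fun y => (s, y + c.encB s v))
      exact c.measurable_decB.comp
        (measurable_const.prodMk (measurable_const.prodMk (h1.add_const zB)))
    have hest : ∀ u z, c.estA ((s, (u, v), z, zA, zB) : Sample k n) = g (c.encA s u + z) := by
      intro u z
      simp only [Code.estA, Code.yB, Code.xR, Code.yR, Code.xA, Code.xB, hg]
      rw [add_right_comm]
    have h := single_user_converse hσ hP (c.encA s) hgm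
    rw [hsum (fun q => q / (2 * (σ ^ 2 + q))) (by simp),
      hsum (fun q => 1 / 2 * Real.log ((σ ^ 2 + q) / σ ^ 2)) (by simp [hs.ne'])] at h
    simp_rw [hen] at h
    rw [show (σ ^ 2 + p) / σ ^ 2 = 1 + p / σ ^ 2 by field_simp] at h
    have h' : k * Real.log 2 + m * p * w ≤ C + (k * Real.log 2 *
        ∫ u, (noiseLaw n σ).real {z | g (c.encA s u + z) ≠ u} ∂msgLaw k +
        w * ∫ u, energy (c.encA s u) ∂msgLaw k) := by
      rw [← integral_const_mul w]
      have : ∀ u, w * energy (c.encA s u) = energy (c.encA s u) / (2 * (σ ^ 2 + p)) := fun u => by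
        rw [hw]; ring
      simp_rw [this]
      calc _ = _ := by rw [hw]; ring
        _ ≤ _ := h
        _ = _ := by rw [hC]; ring
    have e0 : 0 ≤ ∫ u, (noiseLaw n σ).real {z | g (c.encA s u + z) ≠ u} ∂msgLaw k :=
      integral_nonneg fun _ => measureReal_nonneg
    have e1 : 0 ≤ ∫ u, energy (c.encA s u) ∂msgLaw k := integral_nonneg fun _ => energy_nonneg _
    refine (ENNReal.ofReal_le_ofReal h').trans (le_of_eq ?_)
    have hK : 0 ≤ k * Real.log 2 := by positivity
    rw [ENNReal.ofReal_add hC0 (add_nonneg (mul_nonneg hK e0) (mul_nonneg hw0 e1)),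
      ENNReal.ofReal_add (mul_nonneg hK e0) (mul_nonneg hw0 e1),
      ENNReal.ofReal_mul hK, ENNReal.ofReal_mul hw0,
      ofReal_integral_eq_lintegral_ofReal Integrable.of_finite
        (ae_of_all _ fun _ => measureReal_nonneg),
      ofReal_integral_eq_lintegral_ofReal Integrable.of_finite
        (ae_of_all _ fun _ => energy_nonneg _)]
    congr 3
    · refine lintegral_congr fun u => ?_
      have hE : MeasurableSet {z | g (c.encA s u + z) ≠ u} :=
        (hgm.comp (measurable_const_add (c.encA s u))) (measurableSet_singleton u).compl
      rw [ofReal_measureReal, ← lintegral_indicator_one hE]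
      refine lintegral_congr fun z => ?_
      simp [Set.indicator, hest]
    · simp [Code.xA]
  have hset : MeasurableSet {ω : Sample k n | c.estA ω ≠ ω.2.1.1} :=
    (measurableSet_eq_fun c.measurable_estA (by fun_prop)).compl
  have hm1 : Measurable fun ω : Sample k n =>
      ({ω | c.estA ω ≠ ω.2.1.1} : Set (Sample k n)).indicator (1 : Sample k n → ℝ≥0∞) ω :=
    measurable_one.indicator hset
  have hm2 : Measurable fun ω : Sample k n => ENNReal.ofReal (energy (c.xA ω)) :=
    (measurable_energy.comp c.measurable_xA).ennreal_ofReal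
  have hsum2 : ENNReal.ofReal (k * Real.log 2 + m * p * w) ≤ ENNReal.ofReal C +
      (ENNReal.ofReal (k * Real.log 2) * c.errorProb σ +
        ENNReal.ofReal w * ENNReal.ofReal (m * p)) := by
    have h := lintegral_mono (μ := (c.seedLaw : Measure ℝ).prod
      ((msgLaw k).prod ((noiseLaw n σ).prod (noiseLaw n σ)))) hcond
    rw [lintegral_add_left measurable_const,
      lintegral_add_left ((measurable_lintegral_msg_noise σ hm1).const_mul _),
      lintegral_const_mul' _ _ ENNReal.ofReal_ne_top,
      lintegral_const_mul' _ _ ENNReal.ofReal_ne_top, ← c.lintegral_law σ hm1,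
      ← c.lintegral_law σ hm2, lintegral_indicator_one hset] at h
    simp only [lintegral_const, measure_univ, mul_one] at h
    refine h.trans ?_
    gcongr
    · exact measure_mono fun ω hω => Or.inl hω
    · exact hpow
  have hne : c.errorProb σ ≠ ∞ := measure_ne_top _ _
  rw [← ENNReal.ofReal_toReal hne, ← ENNReal.ofReal_mul (by positivity), ← ENNReal.ofReal_mul hw0,
    ← ENNReal.ofReal_add (by positivity) (by positivity),
    ← ENNReal.ofReal_add hC0 (by positivity), ENNReal.ofReal_le_ofReal_iff (by positivity)] at hsum2
  linarith

/-- The asymptotic form of the bound of `Code.converse`. -/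
lemma rate_le_of_forall_le {k : ℕ → ℕ} {pe : ℕ → ℝ≥0∞} {R c : ℝ}
    (hk : Tendsto (fun n => (k n : ℝ) / n) atTop (𝓝 R)) (hpe : Tendsto pe atTop (𝓝 0))
    (h : ∀ n : ℕ, k n * Real.log 2 ≤
      Real.log 2 + n * c + k n * Real.log 2 * (pe n).toReal) : R ≤ c / Real.log 2 := by
  have hl : 0 < Real.log 2 := Real.log_pos one_lt_two
  have hpe' : Tendsto (fun n => (pe n).toReal) atTop (𝓝 0) := by
    exact (ENNReal.tendsto_toReal ENNReal.zero_ne_top).comp hpe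
  have h1 : Tendsto (fun n : ℕ => Real.log 2 / n + c +
      (k n : ℝ) / n * Real.log 2 * (pe n).toReal) atTop (𝓝 (0 + c + R * Real.log 2 * 0)) :=
    ((tendsto_const_div_atTop_nhds_zero_nat _).add_const c).add ((hk.mul_const _).mul hpe')
  have h2 := le_of_tendsto_of_tendsto (hk.mul_const (Real.log 2)) h1 (by
    filter_upwards [eventually_gt_atTop 0] with n hn
    have hn' : (0 : ℝ) < n := by exact_mod_cast hn
    have := div_le_div_of_nonneg_right (h n) hn'.le
    calc _ = _ := by ring
      _ ≤ _ := this
      _ = _ := by field_simp)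
  rw [le_div_iff₀ hl]
  simpa using h2

/-- The cut-set bound. -/
theorem Achievable.le_upperBound {P σ R : ℝ} (hP : 0 < P) (hσ : 0 < σ) (h : Achievable P σ R) :
    R ≤ upperBound P σ := by
  obtain ⟨k, c, hpow, herr, hk⟩ := h
  refine (rate_le_of_forall_le (c := 1 / 2 * Real.log (1 + P / σ ^ 2)) hk herr fun n => ?_).trans
    (le_of_eq ?_)
  · exact (c n).converse hσ hP.le le_rfl (fun _ _ i hi => absurd i.2 (not_lt.2 hi)) (hpow n).1
  · rw [upperBound, Real.logb]; ring

/-- In the multiple access phase, time sharing halves the number of channel uses of `A`. -/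
theorem JDAchievable.le_jdRate {P σ R : ℝ} (hP : 0 < P) (hσ : 0 < σ) (h : JDAchievable P σ R) :
    R ≤ jdRate P σ := by
  obtain ⟨k, c, hpow, -, herr, hk⟩ := h
  refine (rate_le_of_forall_le (c := 1 / 2 * (1 / 2 * Real.log (1 + 2 * P / σ ^ 2))) hk herr
    fun n => ?_).trans (le_of_eq ?_)
  · refine ((c n).toCode.converse hσ (by positivity : 0 ≤ 2 * P) (Nat.div_le_self n 2)
      (fun _ u i hi => (c n).silentA u i hi) (hpow n).2.1).trans ?_
    have h1 : ((n / 2 : ℕ) : ℝ) ≤ n * (1 / 2) := by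
      rw [mul_one_div]; exact_mod_cast Nat.cast_div_le (α := ℝ) (m := n) (n := 2)
    have h2 : 0 ≤ 1 / 2 * Real.log (1 + 2 * P / σ ^ 2) :=
      mul_nonneg (by norm_num) (Real.log_nonneg (by simp; positivity))
    rw [← mul_assoc (n : ℝ)]
    gcongr
  · rw [jdRate, Real.logb]; ring

/-! ### Maximal codes for an additive noise channel -/

/-- Feinstein's maximal code construction. A pair `(x, y)` in `D` is one for which `x` explains the
output `y`. A codeword may be added to a list as long as the outputs explained by the codewords
so far are unlikely when the input is random with law `Q`: a random input then works with
positive probability. -/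
lemma exists_maximal_code {n : ℕ} {Q N : Measure (Signal n)} [IsProbabilityMeasure Q]
    [IsProbabilityMeasure N] {F : Set (Signal n)} (hF : MeasurableSet F)
    {D : Set (Signal n × Signal n)} (hD : MeasurableSet D) {η δ ε : ℝ≥0∞}
    (hη : (Q.prod N) {p | ¬(p.1 ∈ F ∧ (p.1, p.1 + p.2) ∈ D)} ≤ η)
    (hδ : ∀ x, (Q.prod N) {p | (x, p.1 + p.2) ∈ D} ≤ δ) (hε : ε < 1) (M : ℕ)
    (hM : η + M * δ ≤ ε) :
    ∃ x : ℕ → Signal n, ∀ i < M, x i ∈ F ∧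
      N {z | ¬((x i, x i + z) ∈ D ∧ ∀ j < i, (x j, x i + z) ∉ D)} ≤ ε := by
  induction M with
  | zero => exact ⟨0, fun i hi => absurd hi (Nat.not_lt_zero i)⟩
  | succ M ih =>
    have hM' : η + M * δ ≤ ε := le_trans (by gcongr; simp) hM
    obtain ⟨x, hx⟩ := ih hM'
    set B : Set (Signal n × Signal n) := {p | ¬(p.1 ∈ F ∧ (p.1, p.1 + p.2) ∈ D)} ∪
      ⋃ j ∈ Finset.range M, {p | (x j, p.1 + p.2) ∈ D} with hB
    have hBm : MeasurableSet B := by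
      refine MeasurableSet.union ?_ (Finset.measurableSet_biUnion _ fun j _ => ?_)
      · exact ((measurable_fst hF).inter
          ((by fun_prop : Measurable fun p : Signal n × Signal n => (p.1, p.1 + p.2)) hD)).compl
      · exact (by fun_prop : Measurable fun p : Signal n × Signal n => (x j, p.1 + p.2)) hD
    have hBle : (Q.prod N) B ≤ ε := by
      calc _ ≤ η + ∑ j ∈ Finset.range M, δ := (measure_union_le _ _).trans
            (add_le_add hη ((measure_biUnion_finset_le _ _).trans
              (Finset.sum_le_sum fun j _ => hδ (x j))))
        _ ≤ ε := by simpa using hM'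
    rw [Measure.prod_apply hBm] at hBle
    obtain ⟨a, ha⟩ := exists_le_lintegral (μ := Q)
      (measurable_measure_prodMk_left (ν := N) hBm).aemeasurable
    have ha' := ha.trans hBle
    have haF : a ∈ F := by
      by_contra h
      have : Prod.mk a ⁻¹' B = Set.univ := Set.eq_univ_of_forall fun z => Or.inl fun h' => h h'.1
      rw [this, measure_univ] at ha'
      exact absurd ha' (not_le.2 hε)
    refine ⟨Function.update x M a, fun i hi => ?_⟩
    rcases Nat.lt_succ_iff_lt_or_eq.1 hi with h | rfl
    · have h1 : ∀ j ≤ i, Function.update x M a j = x j := fun j hj =>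
        Function.update_of_ne (hj.trans_lt h).ne _ _
      rw [h1 i le_rfl]
      refine ⟨(hx i h).1, (measure_mono ?_).trans (hx i h).2⟩
      refine fun z hz hz' => hz ⟨hz'.1, fun j hj => ?_⟩
      rw [h1 j hj.le]
      exact hz'.2 j hj
    · rw [Function.update_self]
      refine ⟨haF, le_trans (measure_mono fun z hz => ?_) ha'⟩
      by_contra hz'
      simp only [hB, Set.mem_preimage, Set.mem_union, Set.mem_ofPred_eq, not_or, not_not,
        Set.mem_iUnion, not_exists, Finset.mem_range] at hz'
      refine hz ⟨hz'.1.2, fun j hj => ?_⟩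
      rw [Function.update_of_ne hj.ne]
      exact hz'.2 j hj

/-- Decoding to the first codeword that explains the output. -/
lemma exists_decoder {n k : ℕ} {N : Measure (Signal n)} {F : Set (Signal n)}
    {D : Set (Signal n × Signal n)} (hD : MeasurableSet D) {ε : ℝ≥0∞} {x : ℕ → Signal n}
    (hx : ∀ i < 2 ^ k, x i ∈ F ∧
      N {z | ¬((x i, x i + z) ∈ D ∧ ∀ j < i, (x j, x i + z) ∉ D)} ≤ ε) :
    ∃ (e : Msg k → Signal n) (g : Signal n → Msg k), Measurable g ∧
      ∀ u, e u ∈ F ∧ N {z | g (e u + z) ≠ u} ≤ ε := by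
  classical
  have e : Msg k ≃ Fin (2 ^ k) := Fintype.equivFinOfCardEq (by simp)
  have hex : ∀ y, ∃ i, (x i, y) ∈ D ∨ i = 2 ^ k := fun y => ⟨_, Or.inr rfl⟩
  have hidx : Measurable fun y => Nat.find (hex y) := by
    refine measurable_find hex fun i => ?_
    exact (measurable_prodMk_left hD).union (MeasurableSet.const _)
  refine ⟨fun u => x (e u), fun y => if h : Nat.find (hex y) < 2 ^ k then e.symm ⟨_, h⟩ else
    fun _ => false, ?_, fun u => ⟨(hx _ (e u).2).1, ?_⟩⟩
  · exact (Measurable.of_discrete (f := fun i : ℕ => if h : i < 2 ^ k then e.symm ⟨i, h⟩ else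
      fun _ => false)).comp hidx
  · refine (measure_mono ?_).trans (hx _ (e u).2).2
    refine fun z hz hz' => hz ?_
    have : Nat.find (hex (x (e u) + z)) = e u := by
      rw [Nat.find_eq_iff]
      exact ⟨Or.inl hz'.1, fun j hj => not_or.2 ⟨hz'.2 j hj, (hj.trans (e u).2).ne⟩⟩
    simp [this]

/-! ### Codes for the Gaussian channel -/

/-- The pairs of a channel input `x` and an output `y` for which the noise `y - x` is not too strong
and the output is not too weak. -/
def typicalPairs (n : ℕ) (a b : ℝ) : Set (Signal n × Signal n) :=
  {p | energy (p.2 - p.1) ≤ n * a ∧ n * b ≤ energy p.2}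

lemma measurableSet_typicalPairs (n : ℕ) (a b : ℝ) : MeasurableSet (typicalPairs n a b) :=
  (measurableSet_le (measurable_energy.comp (measurable_snd.sub measurable_fst))
    measurable_const).inter (measurableSet_le measurable_const
      (measurable_energy.comp measurable_snd))

lemma infoDensity_const {n : ℕ} (σ S : ℝ) (x z : Signal n) :
    infoDensity σ (fun _ => S) x z = n * (1 / 2 * Real.log ((σ ^ 2 + S) / σ ^ 2)) +
      energy (x + z) / (2 * (σ ^ 2 + S)) - energy z / (2 * σ ^ 2) := by
  simp [infoDensity, energy, Finset.sum_add_distrib, Finset.sum_div]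

lemma gaussianVector_typical_le {n : ℕ} {σ S δ : ℝ} (hσ : 0 < σ) (hS : 0 ≤ S) (x : Signal n) :
    gaussianVector (fun _ => σ ^ 2 + S)
        {y | (x, y) ∈ typicalPairs n (σ ^ 2 + δ) (σ ^ 2 + S - δ)} ≤
      ENNReal.ofReal (Real.exp (-(n * (1 / 2 * Real.log ((σ ^ 2 + S) / σ ^ 2) -
        δ / (2 * (σ ^ 2 + S)) - δ / (2 * σ ^ 2))))) := by
  have hm : MeasurableSet {y | (x, y) ∈ typicalPairs n (σ ^ 2 + δ) (σ ^ 2 + S - δ)} :=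
    measurable_prodMk_left (measurableSet_typicalPairs n _ _)
  have hs : 0 < σ ^ 2 := by positivity
  rw [← lintegral_indicator_one hm, lintegral_gaussianVector hσ (P := fun _ => S) (fun _ => hS) x
    (measurable_one.indicator hm)]
  refine (lintegral_mono (g := fun _ => ENNReal.ofReal (Real.exp
    (-(n * (1 / 2 * Real.log ((σ ^ 2 + S) / σ ^ 2) - δ / (2 * (σ ^ 2 + S)) -
      δ / (2 * σ ^ 2)))))) fun z => ?_).trans (by simp)
  by_cases h : x + z ∈ {y | (x, y) ∈ typicalPairs n (σ ^ 2 + δ) (σ ^ 2 + S - δ)}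
  · rw [Set.indicator_of_mem h, Pi.one_apply, one_mul]
    refine ENNReal.ofReal_le_ofReal (Real.exp_le_exp.2 (neg_le_neg ?_))
    obtain ⟨h1, h2⟩ := h
    simp only [add_sub_cancel_left] at h1 h2
    rw [infoDensity_const]
    have h3 : n * (σ ^ 2 + S - δ) / (2 * (σ ^ 2 + S)) ≤ energy (x + z) / (2 * (σ ^ 2 + S)) := by
      gcongr
    have h4 : energy z / (2 * σ ^ 2) ≤ n * (σ ^ 2 + δ) / (2 * σ ^ 2) := by gcongr
    have h5 : n * (σ ^ 2 + S - δ) / (2 * (σ ^ 2 + S)) - n * (σ ^ 2 + δ) / (2 * σ ^ 2) =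
        n * (-(δ / (2 * (σ ^ 2 + S))) - δ / (2 * σ ^ 2)) := by
      have : σ ^ 2 + S ≠ 0 := by positivity
      field_simp
      ring
    linarith
  · rw [Set.indicator_of_notMem h, zero_mul]
    exact zero_le

/-- A Gaussian input of power `S` and the resulting output are typical, and the input has
energy at most `n * (S + δ)`, except with a probability that tends to `0`. -/
lemma exists_atypical_le {σ S δ : ℝ} (hS : 0 ≤ S) (hδ : 0 < δ) :
    ∃ η : ℕ → ℝ≥0∞, Tendsto η atTop (𝓝 0) ∧ ∀ n, 0 < n →
      ((gaussianVector fun _ : Fin n => S).prod (noiseLaw n σ))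
        {p | ¬(p.1 ∈ {x | energy x ≤ n * (S + δ)} ∧
          (p.1, p.1 + p.2) ∈ typicalPairs n (σ ^ 2 + δ) (σ ^ 2 + S - δ))} ≤ η n := by
  obtain ⟨C₁, h₁⟩ := exists_energy_deviation_le S hS
  obtain ⟨C₂, h₂⟩ := exists_energy_deviation_le (σ ^ 2) (sq_nonneg σ)
  obtain ⟨C₃, h₃⟩ := exists_energy_deviation_le (σ ^ 2 + S) (by positivity)
  have hlim : ∀ C : ℝ, Tendsto (fun n : ℕ => ENNReal.ofReal (C / (n * δ ^ 2))) atTop (𝓝 0) := by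
    intro C
    have : Tendsto (fun n : ℕ => C / (n * δ ^ 2)) atTop (𝓝 0) := by
      have := tendsto_const_div_atTop_nhds_zero_nat (C / δ ^ 2)
      refine this.congr fun n => ?_
      rw [div_div, mul_comm]
    simpa using ENNReal.tendsto_ofReal this
  refine ⟨fun n => ENNReal.ofReal (C₁ / (n * δ ^ 2)) + (ENNReal.ofReal (C₂ / (n * δ ^ 2)) +
    ENNReal.ofReal (C₃ / (n * δ ^ 2))), by simpa using (hlim C₁).add ((hlim C₂).add (hlim C₃)),
    fun n hn => ?_⟩
  set μ := (gaussianVector fun _ : Fin n => S).prod (noiseLaw n σ) with hμ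
  have hdev : ∀ v : ℝ, MeasurableSet {z : Signal n | n * δ ≤ |energy z - n * v|} := fun v =>
    measurableSet_le measurable_const (measurable_energy.sub_const _).abs
  have e₁ : μ (Prod.fst ⁻¹' {z | n * δ ≤ |energy z - n * S|}) ≤
      ENNReal.ofReal (C₁ / (n * δ ^ 2)) := by
    rw [measurePreserving_fst.measure_preimage (hdev S).nullMeasurableSet]
    exact h₁ n δ hδ hn
  have e₂ : μ (Prod.snd ⁻¹' {z | n * δ ≤ |energy z - n * σ ^ 2|}) ≤
      ENNReal.ofReal (C₂ / (n * δ ^ 2)) := by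
    rw [measurePreserving_snd.measure_preimage (hdev _).nullMeasurableSet]
    exact h₂ n δ hδ hn
  have e₃ : μ ((fun p => p.1 + p.2) ⁻¹' {z | n * δ ≤ |energy z - n * (σ ^ 2 + S)|}) ≤
      ENNReal.ofReal (C₃ / (n * δ ^ 2)) := by
    rw [← Measure.map_apply (by fun_prop) (hdev _), hμ, noiseLaw_eq,
      map_add_gaussianVector (fun _ => hS) fun _ => sq_nonneg σ]
    simp_rw [add_comm S]
    exact h₃ n δ hδ hn
  refine le_trans (measure_mono (t := Prod.fst ⁻¹' {z | n * δ ≤ |energy z - n * S|} ∪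
    (Prod.snd ⁻¹' {z | n * δ ≤ |energy z - n * σ ^ 2|} ∪
      (fun p => p.1 + p.2) ⁻¹' {z | n * δ ≤ |energy z - n * (σ ^ 2 + S)|})) ?_)
    ((measure_union_le _ _).trans (add_le_add e₁ ((measure_union_le _ _).trans
      (add_le_add e₂ e₃))))
  rintro ⟨x, z⟩ hp
  by_contra h
  simp only [Set.mem_union, Set.mem_preimage, Set.mem_ofPred_eq, not_or, not_le, abs_lt] at h
  refine hp ⟨?_, ?_, ?_⟩
  · simp only [Set.mem_ofPred_eq]; linarith [h.1.2]
  · simp only [add_sub_cancel_left]; linarith [h.2.1.2]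
  · linarith [h.2.2.1]

/-- Achievability for the Gaussian channel: at every rate below capacity there are codes all of
whose codewords satisfy the power constraint and have a small error probability. -/
lemma eventually_exists_gaussian_code {σ S R : ℝ} (hσ : 0 < σ) (hS : 0 < S)
    (hR : R < 1 / 2 * Real.logb 2 (1 + S / σ ^ 2)) {ε : ℝ≥0∞} (hε : 0 < ε) :
    ∀ᶠ n : ℕ in atTop, ∀ k : ℕ, (k : ℝ) ≤ n * R →
      ∃ (x : Msg k → Signal n) (g : Signal n → Msg k), Measurable g ∧
        ∀ u, energy (x u) ≤ n * S ∧ noiseLaw n σ {z | g (x u + z) ≠ u} ≤ ε := by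
  wlog hε1 : ε < 1 generalizing ε
  · filter_upwards [this (ε := 2⁻¹) (by simp) ENNReal.one_half_lt_one] with n hn k hk
    obtain ⟨x, g, hg, h⟩ := hn k hk
    exact ⟨x, g, hg, fun u => ⟨(h u).1, (h u).2.trans
      (ENNReal.one_half_lt_one.le.trans (not_lt.1 hε1))⟩⟩
  have hs : 0 < σ ^ 2 := by positivity
  have hl : 0 < Real.log 2 := Real.log_pos one_lt_two
  set E : ℝ → ℝ := fun δ => 1 / 2 * Real.log ((σ ^ 2 + (S - δ)) / σ ^ 2) -
    δ / (2 * (σ ^ 2 + (S - δ))) - δ / (2 * σ ^ 2) with hE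
  have hR' : R * Real.log 2 < E 0 := by
    have : E 0 = 1 / 2 * Real.logb 2 (1 + S / σ ^ 2) * Real.log 2 := by
      rw [hE, Real.logb, show 1 + S / σ ^ 2 = (σ ^ 2 + S) / σ ^ 2 by field_simp]
      field_simp
      simp
    rw [this]
    exact mul_lt_mul_of_pos_right hR hl
  have hcont : ContinuousAt E 0 := by
    have h1 : (σ ^ 2 + (S - 0)) / σ ^ 2 ≠ 0 := by rw [sub_zero]; positivity
    have h2 : 2 * (σ ^ 2 + (S - 0)) ≠ 0 := by rw [sub_zero]; positivity
    have h3 : σ ^ 2 ≠ 0 := hs.ne'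
    rw [hE]
    fun_prop (disch := assumption)
  -- the input has power `S - δ`, so that its energy rarely exceeds `n * S`
  obtain ⟨δ, hδE, hδ0, hδS⟩ : ∃ δ, R * Real.log 2 < E δ ∧ 0 < δ ∧ δ < S := by
    have h1 : ∀ᶠ δ in 𝓝[>] (0 : ℝ), R * Real.log 2 < E δ :=
      (hcont.eventually (lt_mem_nhds hR')).filter_mono nhdsWithin_le_nhds
    exact (h1.and (Ioo_mem_nhdsGT hS)).exists
  obtain ⟨η, hη0, hη⟩ := exists_atypical_le (σ := σ) (sub_nonneg.2 hδS.le) hδ0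
  have hdecay : Tendsto (fun n : ℕ => η n + ENNReal.ofReal (Real.exp (-(n * (E δ - R * Real.log 2)))))
      atTop (𝓝 0) := by
    have h1 : Tendsto (fun n : ℕ => Real.exp (-(n * (E δ - R * Real.log 2)))) atTop (𝓝 0) :=
      Real.tendsto_exp_neg_atTop_nhds_zero.comp
        (tendsto_natCast_atTop_atTop.atTop_mul_const (sub_pos.2 hδE))
    simpa using hη0.add (ENNReal.tendsto_ofReal h1)
  filter_upwards [hdecay.eventually (ge_mem_nhds hε), eventually_gt_atTop 0] with n hn hn0 k hk
  have hD := measurableSet_typicalPairs n (σ ^ 2 + δ) (σ ^ 2 + (S - δ) - δ)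
  have hFm : MeasurableSet {x : Signal n | energy x ≤ n * (S - δ + δ)} :=
    measurableSet_le measurable_energy measurable_const
  have hQ : ∀ x : Signal n, ((gaussianVector fun _ : Fin n => S - δ).prod (noiseLaw n σ))
      {p | (x, p.1 + p.2) ∈ typicalPairs n (σ ^ 2 + δ) (σ ^ 2 + (S - δ) - δ)} ≤
      ENNReal.ofReal (Real.exp (-(n * E δ))) := fun x => by
    have := gaussianVector_typical_le (n := n) (δ := δ) hσ (sub_nonneg.2 hδS.le) x
    refine le_trans (le_of_eq ?_) this
    have h := map_add_gaussianVector (n := n) (v := fun _ => S - δ) (w := fun _ => σ ^ 2)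
      (fun _ => sub_nonneg.2 hδS.le) fun _ => hs.le
    simp_rw [add_comm (S - δ)] at h
    have hy : MeasurableSet {y | (x, y) ∈ typicalPairs n (σ ^ 2 + δ) (σ ^ 2 + (S - δ) - δ)} :=
      measurable_prodMk_left hD
    rw [← h, Measure.map_apply (by fun_prop) hy, noiseLaw_eq]
    rfl
  have hcount : (2 ^ k : ℕ) * ENNReal.ofReal (Real.exp (-(n * E δ))) ≤
      ENNReal.ofReal (Real.exp (-(n * (E δ - R * Real.log 2)))) := by
    rw [← ENNReal.ofReal_natCast, ← ENNReal.ofReal_mul (by positivity)]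
    refine ENNReal.ofReal_le_ofReal ?_
    have : ((2 ^ k : ℕ) : ℝ) = Real.exp (k * Real.log 2) := by
      rw [mul_comm, ← Real.rpow_def_of_pos two_pos, Real.rpow_natCast]
      push_cast
      rfl
    rw [this, ← Real.exp_add]
    refine Real.exp_le_exp.2 ?_
    have := mul_le_mul_of_nonneg_right hk hl.le
    linarith
  obtain ⟨x, hx⟩ := exists_maximal_code hFm hD (hη n hn0) hQ hε1 (2 ^ k)
    ((add_le_add_right hcount (η n)).trans hn)
  obtain ⟨e, g, hg, h⟩ := exists_decoder hD hx
  exact ⟨e, g, hg, fun u => ⟨by simpa using (h u).1, (h u).2⟩⟩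

/-! ### The time-shared joint decoding scheme -/

lemma bxor_self_left {k : ℕ} (u v : Msg k) : bxor u (bxor u v) = v := by
  ext i; simp [bxor]

lemma bxor_comm {k : ℕ} (u v : Msg k) : bxor u v = bxor v u := by
  ext i; simp [bxor, Bool.xor_comm]

lemma energy_extend {m n : ℕ} {e : Fin m → Fin n} (he : Function.Injective e) (x : Signal m) :
    energy (Function.extend e x 0) = energy x := by
  refine (Fintype.sum_of_injective e he _ _ (fun i hi => ?_) fun i => ?_).symm
  · rw [Function.extend_apply' _ _ _ (by simpa using hi)]; simp
  · rw [he.extend_apply]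

/-- The noise in a selection of distinct channel uses is again white Gaussian noise. -/
lemma map_noiseLaw_comp {m n : ℕ} {e : Fin m → Fin n} (he : Function.Injective e) (σ : ℝ) :
    (noiseLaw n σ).map (fun z => z ∘ e) = noiseLaw m σ := by
  have h := (iIndepFun_pi (μ := fun _ : Fin n => gaussianReal 0 (σ ^ 2).toNNReal)
    (X := fun _ => id) fun _ => aemeasurable_id).precomp he
  have h' := (iIndepFun_iff_map_fun_eq_pi_map (f := fun (i : Fin m) (z : Signal n) => z (e i))
    fun i => (measurable_pi_apply (e i)).aemeasurable).1 h
  refine h'.trans ?_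
  unfold noiseLaw
  congr 1
  ext1 i
  exact (measurePreserving_eval (fun _ : Fin n => gaussianReal 0 (σ ^ 2).toNNReal) (e i)).map_eq

/-- A bound on the probability of an event given the messages is a bound on its probability. -/
lemma Code.law_le {k n : ℕ} (c : Code k n) (σ : ℝ)
    {B : Msg k × Msg k → Set (Signal n × Signal n × Signal n)} (hB : ∀ p, MeasurableSet (B p))
    {ε : ℝ≥0∞} (h : ∀ p, ((noiseLaw n σ).prod ((noiseLaw n σ).prod (noiseLaw n σ))) (B p) ≤ ε) :
    c.law σ {ω | ω.2.2 ∈ B ω.2.1} ≤ ε := by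
  have hT : MeasurableSet
      {q : (Msg k × Msg k) × Signal n × Signal n × Signal n | q.2 ∈ B q.1} := by
    have : {q : (Msg k × Msg k) × Signal n × Signal n × Signal n | q.2 ∈ B q.1} =
        ⋃ p, {p} ×ˢ B p := by ext ⟨a, b⟩; simp
    rw [this]
    exact MeasurableSet.iUnion fun p => (measurableSet_singleton p).prod (hB p)
  have e := (measurePreserving_snd (μ := (c.seedLaw : Measure ℝ))
    (ν := ((msgLaw k).prod (msgLaw k)).prod
      ((noiseLaw n σ).prod ((noiseLaw n σ).prod (noiseLaw n σ))))).measure_preimage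
    hT.nullMeasurableSet
  refine (show c.law σ {ω | ω.2.2 ∈ B ω.2.1} = _ from e).trans_le ?_
  rw [Measure.prod_apply hT]
  exact (lintegral_mono fun p => h p).trans (by simp)

/-- The scheme built from a code `(xa, ga)` for one half of the multiple access phase, used by both
terminals, and a code `(xr, gr)` for the broadcast phase. -/
def JDCode.ofCodes {k n : ℕ} (xa : Msg k → Signal (n / 2)) (ga : Signal (n / 2) → Msg k)
    (hga : Measurable ga) (xr : Msg k → Signal n) (gr : Signal n → Msg k) (hgr : Measurable gr) :
    JDCode k n where
  encA u := Function.extend (fun j : Fin (n / 2) => (⟨j, by omega⟩ : Fin n)) (xa u) 0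
  encB u := Function.extend (fun j : Fin (n / 2) => (⟨n / 2 + j, by omega⟩ : Fin n)) (xa u) 0
  relayDec y := (ga (y ∘ fun j : Fin (n / 2) => (⟨j, by omega⟩ : Fin n)),
    ga (y ∘ fun j : Fin (n / 2) => (⟨n / 2 + j, by omega⟩ : Fin n)))
  relayEnc := xr
  xorDecA := gr
  xorDecB := gr
  silentA u i hi := Function.extend_apply' _ _ _ fun ⟨j, hj⟩ => by
    have h1 : (j : ℕ) = i := congrArg Fin.val hj
    have h2 := j.2
    omega
  silentB u i hi := Function.extend_apply' _ _ _ fun ⟨j, hj⟩ => by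
    have h1 : n / 2 + (j : ℕ) = i := congrArg Fin.val hj
    have h2 := j.2
    omega
  measurable_relayDec := (hga.comp (by fun_prop)).prodMk (hga.comp (by fun_prop))
  measurable_xorDecA := hgr
  measurable_xorDecB := hgr

section ofCodes

variable {k n : ℕ} {xa : Msg k → Signal (n / 2)} {ga : Signal (n / 2) → Msg k}
  {hga : Measurable ga} {xr : Msg k → Signal n} {gr : Signal n → Msg k} {hgr : Measurable gr}

lemma firstHalf_injective :
    Function.Injective fun j : Fin (n / 2) => (⟨j, by omega⟩ : Fin n) := fun a b h =>
  Fin.ext (by simpa using h)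

lemma secondHalf_injective :
    Function.Injective fun j : Fin (n / 2) => (⟨n / 2 + j, by omega⟩ : Fin n) := fun a b h =>
  Fin.ext (by simpa using h)

lemma Code.meanEnergy_le (c : Code k n) (σ : ℝ) {x : Sample k n → Signal n} {E : ℝ}
    (h : ∀ ω, energy (x ω) ≤ E) : c.meanEnergy σ x ≤ ENNReal.ofReal E :=
  (lintegral_mono fun ω => ENNReal.ofReal_le_ofReal (h ω)).trans (by simp)

lemma JDCode.powerConstraint_ofCodes {P σ : ℝ} (hP : 0 ≤ P)
    (ha : ∀ u, energy (xa u) ≤ (n / 2 : ℕ) * (2 * P)) (hr : ∀ u, energy (xr u) ≤ n * P) :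
    (JDCode.ofCodes xa ga hga xr gr hgr).PowerConstraint P σ := by
  have h : ((n / 2 : ℕ) : ℝ) * (2 * P) ≤ n * P := by
    have : ((n / 2 : ℕ) : ℝ) ≤ n / 2 := Nat.cast_div_le
    nlinarith
  have hA : ∀ ω, energy ((JDCode.ofCodes xa ga hga xr gr hgr).toCode.xA ω) ≤
      (n / 2 : ℕ) * (2 * P) := fun ω => (energy_extend firstHalf_injective _).trans_le (ha _)
  have hB : ∀ ω, energy ((JDCode.ofCodes xa ga hga xr gr hgr).toCode.xB ω) ≤
      (n / 2 : ℕ) * (2 * P) := fun ω => (energy_extend secondHalf_injective _).trans_le (ha _)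
  exact ⟨⟨Code.meanEnergy_le _ _ fun ω => (hA ω).trans h,
    Code.meanEnergy_le _ _ fun ω => (hB ω).trans h, Code.meanEnergy_le _ _ fun ω => hr _⟩,
    Code.meanEnergy_le _ _ hA, Code.meanEnergy_le _ _ hB⟩

/-- In its own half of the multiple access phase each terminal has a channel free of
interference. -/
lemma JDCode.relayDec_ofCodes (ω : Sample k n) :
    (JDCode.ofCodes xa ga hga xr gr hgr).relayDec
      ((JDCode.ofCodes xa ga hga xr gr hgr).toCode.yR ω) =
    (ga (xa ω.2.1.1 + ω.2.2.1 ∘ fun j : Fin (n / 2) => (⟨j, by omega⟩ : Fin n)),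
      ga (xa ω.2.1.2 + ω.2.2.1 ∘ fun j : Fin (n / 2) => (⟨n / 2 + j, by omega⟩ : Fin n))) := by
  set c := JDCode.ofCodes xa ga hga xr gr hgr with hc
  refine Prod.ext (congrArg ga (funext fun j => ?_)) (congrArg ga (funext fun j => ?_))
  · have h1 : c.encA ω.2.1.1 ⟨j, by omega⟩ = xa ω.2.1.1 j :=
      firstHalf_injective.extend_apply (xa ω.2.1.1) 0 j
    have h2 : c.encB ω.2.1.2 ⟨j, by omega⟩ = 0 := c.silentB _ _ (Or.inl j.2)
    change c.encA ω.2.1.1 ⟨j, _⟩ + c.encB ω.2.1.2 ⟨j, _⟩ + _ = _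
    rw [h1, h2, add_zero]
    rfl
  · have h1 : c.encB ω.2.1.2 ⟨n / 2 + j, by omega⟩ = xa ω.2.1.2 j :=
      secondHalf_injective.extend_apply (xa ω.2.1.2) 0 j
    have h2 : c.encA ω.2.1.1 ⟨n / 2 + j, by omega⟩ = 0 := c.silentA _ _ (Nat.le_add_right _ _)
    change c.encA ω.2.1.1 ⟨n / 2 + j, _⟩ + c.encB ω.2.1.2 ⟨n / 2 + j, _⟩ + _ = _
    rw [h1, h2, zero_add]
    rfl

lemma JDCode.relayErrorProb_ofCodes_le {σ : ℝ} {ε : ℝ≥0∞}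
    (ha : ∀ u, noiseLaw (n / 2) σ {z | ga (xa u + z) ≠ u} ≤ ε) :
    (JDCode.ofCodes xa ga hga xr gr hgr).relayErrorProb σ ≤ ε + ε := by
  set c := JDCode.ofCodes xa ga hga xr gr hgr with hc
  have hm : ∀ u, MeasurableSet {z | ga (xa u + z) ≠ u} := fun u =>
    (hga.comp (measurable_const_add (xa u))) (measurableSet_singleton u).compl
  have hsel : ∀ {e : Fin (n / 2) → Fin n}, Function.Injective e →
      ∀ t : Msg k × Msg k → Msg k,
        c.toCode.law σ {ω | ga (xa (t ω.2.1) + ω.2.2.1 ∘ e) ≠ t ω.2.1} ≤ ε := by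
    intro e he t
    have hme : Measurable fun z : Signal n => z ∘ e := by fun_prop
    have hBm : ∀ p, MeasurableSet {z : Signal n | ga (xa (t p) + z ∘ e) ≠ t p} := fun p =>
      hme (hm (t p))
    refine c.toCode.law_le σ (B := fun p => {q | ga (xa (t p) + q.1 ∘ e) ≠ t p})
      (fun p => measurable_fst (hBm p)) fun p => ?_
    refine le_trans (le_of_eq ?_) (ha (t p))
    rw [← map_noiseLaw_comp he, Measure.map_apply hme (hm _)]
    exact measurePreserving_fst.measure_preimage (hBm p).nullMeasurableSet
  refine le_trans (measure_mono ?_) ((measure_union_le _ _).trans (add_le_add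
    (hsel firstHalf_injective Prod.fst) (hsel secondHalf_injective Prod.snd)))
  intro ω hω
  simp only [Set.mem_ofPred_eq, hc, JDCode.relayDec_ofCodes] at hω
  by_contra h
  simp only [Set.mem_union, Set.mem_ofPred_eq, not_or, not_not] at h
  exact hω (Prod.ext h.1 h.2)

lemma JDCode.errorProb_ofCodes_le {σ : ℝ} {ε : ℝ≥0∞}
    (ha : ∀ u, noiseLaw (n / 2) σ {z | ga (xa u + z) ≠ u} ≤ ε)
    (hr : ∀ u, noiseLaw n σ {z | gr (xr u + z) ≠ u} ≤ ε) :
    (JDCode.ofCodes xa ga hga xr gr hgr).toCode.errorProb σ ≤ ε + ε + (ε + ε) := by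
  set c := JDCode.ofCodes xa ga hga xr gr hgr with hc
  have hm : ∀ u, MeasurableSet {z | gr (xr u + z) ≠ u} := fun u =>
    (hgr.comp (measurable_const_add (xr u))) (measurableSet_singleton u).compl
  have hA : c.toCode.law σ {ω | gr (xr (bxor ω.2.1.1 ω.2.1.2) + ω.2.2.2.1) ≠
      bxor ω.2.1.1 ω.2.1.2} ≤ ε := by
    refine c.toCode.law_le σ (B := fun p => {q | gr (xr (bxor p.1 p.2) + q.2.1) ≠ bxor p.1 p.2})
      (fun p => (measurable_fst.comp measurable_snd) (hm _)) fun p => ?_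
    exact ((measurePreserving_fst.comp measurePreserving_snd).measure_preimage
      (hm _).nullMeasurableSet).trans_le (hr (bxor p.1 p.2))
  have hB : c.toCode.law σ {ω | gr (xr (bxor ω.2.1.1 ω.2.1.2) + ω.2.2.2.2) ≠
      bxor ω.2.1.1 ω.2.1.2} ≤ ε := by
    refine c.toCode.law_le σ (B := fun p => {q | gr (xr (bxor p.1 p.2) + q.2.2) ≠ bxor p.1 p.2})
      (fun p => (measurable_snd.comp measurable_snd) (hm _)) fun p => ?_
    exact ((measurePreserving_snd.comp measurePreserving_snd).measure_preimage
      (hm _).nullMeasurableSet).trans_le (hr (bxor p.1 p.2))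
  refine le_trans (measure_mono ?_) ((measure_union_le _ _).trans (add_le_add
    (JDCode.relayErrorProb_ofCodes_le (hga := hga) (xr := xr) (hgr := hgr) ha)
    ((measure_union_le _ _).trans (add_le_add hA hB))))
  intro ω hω
  by_contra h
  simp only [Set.mem_union, Set.mem_ofPred_eq, not_or, not_not] at h
  obtain ⟨h0, h1, h2⟩ := h
  have hx : c.toCode.xR ω = xr (bxor ω.2.1.1 ω.2.1.2) := by
    change xr (bxor (c.relayDec (c.toCode.yR ω)).1 (c.relayDec (c.toCode.yR ω)).2) = _
    rw [hc, h0]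
  refine hω.elim (fun h => h ?_) fun h => h ?_
  · change bxor ω.2.1.2 (gr (c.toCode.xR ω + ω.2.2.2.2)) = _
    rw [hx, h2, bxor_comm ω.2.1.1, bxor_self_left]
  · change bxor ω.2.1.1 (gr (c.toCode.xR ω + ω.2.2.2.1)) = _
    rw [hx, h1, bxor_self_left]

end ofCodes

lemma jdRate_pos {P σ : ℝ} (hP : 0 < P) (hσ : 0 < σ) : 0 < jdRate P σ :=
  mul_pos (by norm_num) (Real.logb_pos one_lt_two (by simp; positivity))

/-- The broadcast phase is not the bottleneck, since `1 + 2 x ≤ (1 + x) ^ 2`. -/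
lemma jdRate_le_upperBound {P σ : ℝ} (hP : 0 < P) (hσ : 0 < σ) :
    jdRate P σ ≤ upperBound P σ := by
  have h : Real.logb 2 (1 + 2 * P / σ ^ 2) ≤ Real.logb 2 ((1 + P / σ ^ 2) ^ 2) := by
    refine Real.logb_le_logb_of_le one_lt_two (by positivity) ?_
    have : 2 * P / σ ^ 2 = 2 * (P / σ ^ 2) := by ring
    rw [this]
    nlinarith [sq_nonneg (P / σ ^ 2)]
  rw [Real.logb_pow] at h
  push_cast at h
  rw [jdRate, upperBound]
  linarith

/-- Below the rate `jdRate`, the point-to-point codes of the two phases fit together. -/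
lemma eventually_exists_jdCode {P σ R : ℝ} (hP : 0 < P) (hσ : 0 < σ) (hR0 : 0 ≤ R)
    (hR : R < jdRate P σ) {ε : ℝ≥0∞} (hε : 0 < ε) :
    ∀ᶠ n : ℕ in atTop, ∃ c : JDCode ⌊R * n⌋₊ n, c.PowerConstraint P σ ∧
      c.relayErrorProb σ ≤ ε + ε ∧ c.toCode.errorProb σ ≤ ε + ε + (ε + ε) := by
  obtain ⟨R₁, hR₁, hR₂⟩ : ∃ R₁, 2 * R < R₁ ∧ R₁ < 1 / 2 * Real.logb 2 (1 + 2 * P / σ ^ 2) :=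
    exists_between (by rw [jdRate] at hR; linarith)
  have hhalf : Tendsto (fun n : ℕ => n / 2) atTop atTop :=
    Nat.tendsto_div_const_atTop two_ne_zero
  -- rounding `n / 2` down costs less than the gap between `2 * R` and `R₁`
  have hround : ∀ᶠ n : ℕ in atTop, R₁ ≤ n * (R₁ - 2 * R) :=
    (tendsto_natCast_atTop_atTop.atTop_mul_const (sub_pos.2 hR₁)).eventually_ge_atTop R₁
  filter_upwards [hhalf.eventually (eventually_exists_gaussian_code hσ (S := 2 * P)
      (by positivity) hR₂ hε),
    eventually_exists_gaussian_code hσ hP (hR.trans_le (jdRate_le_upperBound hP hσ)) hε,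
    hround] with n h1 h2 h3
  have hk : ((⌊R * n⌋₊ : ℕ) : ℝ) ≤ n * R := by
    rw [mul_comm (n : ℝ)]
    exact Nat.floor_le (by positivity)
  have hk' : ((⌊R * n⌋₊ : ℕ) : ℝ) ≤ (n / 2 : ℕ) * R₁ := by
    have : (n : ℝ) ≤ 2 * (n / 2 : ℕ) + 1 := by exact_mod_cast (by omega : n ≤ 2 * (n / 2) + 1)
    nlinarith
  obtain ⟨xa, ga, hga, ha⟩ := h1 _ hk'
  obtain ⟨xr, gr, hgr, hr⟩ := h2 _ hk
  exact ⟨JDCode.ofCodes xa ga hga xr gr hgr,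
    JDCode.powerConstraint_ofCodes hP.le (fun u => (ha u).1) fun u => (hr u).1,
    JDCode.relayErrorProb_ofCodes_le fun u => (ha u).2,
    JDCode.errorProb_ofCodes_le (fun u => (ha u).2) fun u => (hr u).2⟩

/-- How far a joint decoding code is from being reliable at rate `R`. -/
def JDCode.defect {k n : ℕ} (c : JDCode k n) (σ R : ℝ) : ℝ≥0∞ :=
  c.relayErrorProb σ + c.toCode.errorProb σ + ENNReal.ofReal |(k : ℝ) / n - R|

lemma JDCode.relayErrorProb_le_defect {k n : ℕ} (c : JDCode k n) (σ R : ℝ) :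
    c.relayErrorProb σ ≤ c.defect σ R :=
  le_trans le_self_add le_self_add

lemma JDCode.errorProb_le_defect {k n : ℕ} (c : JDCode k n) (σ R : ℝ) :
    c.toCode.errorProb σ ≤ c.defect σ R :=
  le_trans le_add_self le_self_add

lemma JDCode.rateGap_le_defect {k n : ℕ} (c : JDCode k n) (σ R : ℝ) :
    ENNReal.ofReal |(k : ℝ) / n - R| ≤ c.defect σ R :=
  le_add_self

lemma eventually_exists_defect_le {P σ : ℝ} (hP : 0 < P) (hσ : 0 < σ) {ε : ℝ} (hε : 0 < ε) :
    ∀ᶠ n : ℕ in atTop, ∃ (k : ℕ) (c : JDCode k n), c.PowerConstraint P σ ∧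
      c.defect σ (jdRate P σ) ≤ ENNReal.ofReal ε := by
  set ρ := min (ε / 8) (jdRate P σ) with hρ
  have hρ0 : 0 < ρ := lt_min (by positivity) (jdRate_pos hP hσ)
  have hρε : ρ ≤ ε / 8 := min_le_left _ _
  have hR0 : 0 ≤ jdRate P σ - ρ := sub_nonneg.2 (min_le_right _ _)
  have hlim : Tendsto (fun n : ℕ => ((⌊(jdRate P σ - ρ) * n⌋₊ : ℕ) : ℝ) / n) atTop
      (𝓝 (jdRate P σ - ρ)) :=
    (tendsto_nat_floor_mul_div_atTop hR0).comp tendsto_natCast_atTop_atTop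
  filter_upwards [eventually_exists_jdCode hP hσ hR0 (sub_lt_self _ hρ0)
    (ENNReal.ofReal_pos.2 hρ0), Metric.tendsto_nhds.1 hlim ρ hρ0] with n ⟨c, hc, h1, h2⟩ h3
  refine ⟨_, c, hc, (add_le_add (add_le_add h1 h2) (ENNReal.ofReal_le_ofReal
    (q := 2 * ρ) ?_)).trans ?_⟩
  · rw [Real.dist_eq] at h3
    rw [abs_lt] at h3
    rw [abs_le]
    constructor <;> linarith [h3.1, h3.2]
  · simp only [← ENNReal.ofReal_add hρ0.le hρ0.le,
      ← ENNReal.ofReal_add (add_nonneg hρ0.le hρ0.le) (add_nonneg hρ0.le hρ0.le)]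
    rw [← ENNReal.ofReal_add (by positivity) (by positivity),
      ← ENNReal.ofReal_add (by positivity) (by positivity)]
    exact ENNReal.ofReal_le_ofReal (by linarith)

/-- The rate `jdRate` itself is attained: at each block length, take a code whose defect is nearly
minimal. -/
theorem jdAchievable_jdRate {P σ : ℝ} (hP : 0 < P) (hσ : 0 < σ) :
    JDAchievable P σ (jdRate P σ) := by
  set d : ℕ → ℝ≥0∞ := fun n => ⨅ q : {q : Σ k, JDCode k n // q.2.PowerConstraint P σ},
    q.1.2.defect σ (jdRate P σ) with hd
  have hfin : ∀ {k n : ℕ} (c : JDCode k n), c.defect σ (jdRate P σ) ≠ ∞ := fun c =>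
    ENNReal.add_ne_top.2 ⟨ENNReal.add_ne_top.2 ⟨measure_ne_top _ _, measure_ne_top _ _⟩,
      ENNReal.ofReal_ne_top⟩
  have hdle : ∀ {k n : ℕ} (c : JDCode k n), c.PowerConstraint P σ →
      d n ≤ c.defect σ (jdRate P σ) := fun {k n} c hc =>
    iInf_le (fun q : {q : Σ k, JDCode k n // q.2.PowerConstraint P σ} =>
      q.1.2.defect σ (jdRate P σ)) ⟨⟨k, c⟩, hc⟩
  have hne : ∀ n, d n ≠ ∞ := by
    intro n
    have h0 : ((JDCode.ofCodes (k := 0) (n := n) 0 (fun _ _ => false) measurable_const 0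
        (fun _ _ => false) measurable_const).PowerConstraint P σ) := by
      refine JDCode.powerConstraint_ofCodes hP.le (fun u => ?_) fun u => ?_ <;>
      · simp only [energy, Pi.zero_apply]
        simp
        positivity
    exact ne_top_of_le_ne_top (hfin _) (hdle _ h0)
  have hd0 : Tendsto d atTop (𝓝 0) := by
    rw [ENNReal.tendsto_nhds_zero]
    intro ε hε
    obtain ⟨r, hr0, hr⟩ : ∃ r : ℝ, 0 < r ∧ ENNReal.ofReal r ≤ ε := by
      obtain ⟨r, hr, hr'⟩ := ENNReal.lt_iff_exists_nnreal_btwn.1 hε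
      exact ⟨r, by exact_mod_cast hr, by simpa using hr'.le⟩
    filter_upwards [eventually_exists_defect_le hP hσ hr0] with n ⟨k, c, hc, h⟩
    exact (hdle c hc).trans (h.trans hr)
  have hpick : ∀ n : ℕ, ∃ q : {q : Σ k, JDCode k n // q.2.PowerConstraint P σ},
      q.1.2.defect σ (jdRate P σ) < d n + ((n : ℝ≥0∞) + 1)⁻¹ := fun n =>
    iInf_lt_iff.1 (ENNReal.lt_add_right (hne n) (by simp))
  choose q hq using hpick
  have hq0 : Tendsto (fun n => (q n).1.2.defect σ (jdRate P σ)) atTop (𝓝 0) := by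
    refine tendsto_of_tendsto_of_tendsto_of_le_of_le tendsto_const_nhds
      (h := fun n : ℕ => d n + ((n : ℝ≥0∞) + 1)⁻¹) ?_ (fun _ => zero_le) fun n => (hq n).le
    have : Tendsto (fun n : ℕ => ((n : ℝ≥0∞) + 1)⁻¹) atTop (𝓝 0) := by
      have := (tendsto_add_atTop_iff_nat 1).2 ENNReal.tendsto_inv_nat_nhds_zero
      simpa using this
    simpa using hd0.add this
  have hle : ∀ {f : ℕ → ℝ≥0∞}, (∀ n, f n ≤ (q n).1.2.defect σ (jdRate P σ)) →
      Tendsto f atTop (𝓝 0) := fun h =>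
    tendsto_of_tendsto_of_tendsto_of_le_of_le tendsto_const_nhds hq0 (fun _ => zero_le) h
  refine ⟨fun n => (q n).1.1, fun n => (q n).1.2, fun n => (q n).2,
    hle fun n => (q n).1.2.relayErrorProb_le_defect σ _,
    hle fun n => (q n).1.2.errorProb_le_defect σ _, ?_⟩
  have h := hle (f := fun n => ENNReal.ofReal |((q n).1.1 : ℝ) / n - jdRate P σ|)
    fun n => (q n).1.2.rateGap_le_defect σ _
  have h' := (ENNReal.tendsto_toReal ENNReal.zero_ne_top).comp h
  rw [tendsto_iff_dist_tendsto_zero]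
  refine h'.congr fun n => ?_
  simp [Real.dist_eq]

lemma JDAchievable.achievable {P σ R : ℝ} (h : JDAchievable P σ R) : Achievable P σ R := by
  obtain ⟨k, c, hpow, -, herr, hk⟩ := h
  exact ⟨k, fun n => (c n).toCode, fun n => (hpow n).1, herr, hk⟩

/-! ### Low signal-to-noise ratio -/

lemma tendsto_log_div_log :
    Tendsto (fun x : ℝ => Real.log (1 + 2 * x) / (2 * Real.log (1 + x))) (𝓝[>] 0) (𝓝 1) := by
  have hlog : ∀ c : ℝ, Tendsto (fun x : ℝ => Real.log (1 + c * x) / x) (𝓝[>] 0) (𝓝 c) := by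
    intro c
    have h : HasDerivAt (fun x : ℝ => Real.log (1 + c * x)) c 0 := by
      have h1 : HasDerivAt (fun x : ℝ => 1 + c * x) c 0 := by
        simpa using ((hasDerivAt_id (0 : ℝ)).const_mul c).const_add 1
      simpa using h1.log (by simp)
    have h2 := (hasDerivAt_iff_tendsto_slope.1 h).mono_left
      (nhdsWithin_mono (0 : ℝ) fun x (hx : 0 < x) => hx.ne')
    refine h2.congr fun x => ?_
    simp [slope_def_field]
  have h := (hlog 2).div ((hlog 1).const_mul 2) (by norm_num)
  rw [mul_one, div_self two_ne_zero] at h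
  refine h.congr' ?_
  filter_upwards [self_mem_nhdsWithin] with x hx
  have hx' : x ≠ 0 := (show (0 : ℝ) < x from hx).ne'
  simp only [Pi.div_apply, one_mul]
  rw [← mul_div_assoc, div_div_div_cancel_right₀ hx']

lemma tendsto_snr_lowSNR : Tendsto (fun p : ℝ × ℝ => p.1 / p.2 ^ 2) lowSNR (𝓝[>] 0) := by
  rw [tendsto_nhdsWithin_iff]
  refine ⟨tendsto_comap.mono_left inf_le_left, ?_⟩
  filter_upwards [mem_inf_of_right (mem_principal_self _)] with p hp
  exact div_pos hp.1 (pow_pos hp.2 2)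

lemma tendsto_jdRate_div_upperBound :
    Tendsto (fun p : ℝ × ℝ => jdRate p.1 p.2 / upperBound p.1 p.2) lowSNR (𝓝 1) := by
  refine (tendsto_log_div_log.comp tendsto_snr_lowSNR).congr fun p => ?_
  have hl : Real.log 2 ≠ 0 := (Real.log_pos one_lt_two).ne'
  simp only [Function.comp_apply, jdRate, upperBound, Real.logb]
  rw [← mul_div_assoc]
  rcases eq_or_ne (Real.log (1 + p.1 / p.2 ^ 2)) 0 with h | h
  · simp [h]
  · field_simp
    ring

lemma jdRate_le_exchangeCapacity {P σ : ℝ} (hP : 0 < P) (hσ : 0 < σ) :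
    jdRate P σ ≤ exchangeCapacity P σ :=
  le_csSup ⟨_, fun _ h => Achievable.le_upperBound hP hσ h⟩ (jdAchievable_jdRate hP hσ).achievable

lemma exchangeCapacity_le_upperBound {P σ : ℝ} (hP : 0 < P) (hσ : 0 < σ) :
    exchangeCapacity P σ ≤ upperBound P σ :=
  csSup_le ⟨_, (jdAchievable_jdRate hP hσ).achievable⟩ fun _ h => Achievable.le_upperBound hP hσ h

lemma tendsto_jdRate_div_exchangeCapacity :
    Tendsto (fun p : ℝ × ℝ => jdRate p.1 p.2 / exchangeCapacity p.1 p.2) lowSNR (𝓝 1) := by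
  have hpos : ∀ᶠ p in lowSNR, 0 < p.1 ∧ 0 < p.2 := mem_inf_of_right (mem_principal_self _)
  refine tendsto_of_tendsto_of_tendsto_of_le_of_le' tendsto_jdRate_div_upperBound
    tendsto_const_nhds ?_ ?_
  · filter_upwards [hpos] with p hp
    have h0 := jdRate_pos hp.1 hp.2
    exact div_le_div_of_nonneg_left h0.le (h0.trans_le (jdRate_le_exchangeCapacity hp.1 hp.2))
      (exchangeCapacity_le_upperBound hp.1 hp.2)
  · filter_upwards [hpos] with p hp
    have h0 := jdRate_pos hp.1 hp.2
    exact div_le_one_of_le₀ (jdRate_le_exchangeCapacity hp.1 hp.2)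
      (h0.le.trans (jdRate_le_exchangeCapacity hp.1 hp.2))

end BidirRelay

end

theorem mainTheorem6 :
    (∀ P σ : ℝ, 0 < P → 0 < σ →
      IsGreatest {R : ℝ | BidirRelay.JDAchievable P σ R} (BidirRelay.jdRate P σ) ∧
      BidirRelay.Achievable P σ (BidirRelay.jdRate P σ) ∧
      (∀ R : ℝ, BidirRelay.Achievable P σ R → R ≤ BidirRelay.upperBound P σ)) ∧
    Tendsto (fun p : ℝ × ℝ => BidirRelay.jdRate p.1 p.2 / BidirRelay.exchangeCapacity p.1 p.2)
      BidirRelay.lowSNR (𝓝 1) ∧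
    Tendsto (fun p : ℝ × ℝ => BidirRelay.jdRate p.1 p.2 / BidirRelay.upperBound p.1 p.2)
      BidirRelay.lowSNR (𝓝 1) :=
  ⟨fun _ _ hP hσ => ⟨⟨BidirRelay.jdAchievable_jdRate hP hσ, fun _ h => h.le_jdRate hP hσ⟩,
    (BidirRelay.jdAchievable_jdRate hP hσ).achievable, fun _ h => h.le_upperBound hP hσ⟩,
    BidirRelay.tendsto_jdRate_div_exchangeCapacity, BidirRelay.tendsto_jdRate_div_upperBound⟩
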